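/- Let $m,n\ge 0$ be integers with $N=m+n\ge 1$, and let $a_1,\dots,a_m,b_1,\dots,b_n\in\mathbb R$. Consider real random processes with $y_k=0$ for $k\le 0$, $u_k=0$ for $k<0$, and $$y_k+a_1y_{k-1}+\dots+a_my_{k-m}=b_1u_{k-1}+\dots+b_nu_{k-n}+d_k,\qquad k\ge 1.$$ Put $\theta=[a_1,\dots,a_m,b_1,\dots,b_n]^T$ and $\phi_k=[-y_{k-1},\dots,-y_{k-m},u_{k-1},\dots,u_{k-n}]^T$. For a process $x$ write $\bar{\mathbb E}[\{x_k\}]=\lim_{K\to\infty}\frac1K\sum_{l=1}^K\mathbb E[x_l]$. **Assumption 1.** There are a bounded deterministic sequence $(r_k)_{k\ge0}$ and, for finitely many channels $c=1,\dots,q$, a jointly independent family $(e^{(c)}_k)_{k\ge 0,\,c\le q}$ of random variables with zero mean, common variance $\delta_e^2$ and, for every positive integer $p$, $\sup_{k,c}\mathbb E|e^{(c)}_k|^p<\infty$ ($q=1$ is the case of a single scalar sequence), such that for some real filter coefficients $$y_k=\sum_{i=1}^{k}f^{(1)}_i(k)r_{k-i}+\sum_{c=1}^q\sum_{i=0}^{k}f^{(2,c)}_i(k)e^{(c)}_{k-i}\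 (k\ge1),\qquad u_k=\sum_{i=0}^{k}f^{(3)}_i(k)r_{k-i}+\sum_{c=1}^q\sum_{i=0}^{k}f^{(4,c)}_i(k)e^{(c)}_{k-i}\ (k\ge0),$$ where: (i) there is $(f_i)_{i\ge1}$ with $\sum_i|f_i|<\infty$ such that all these coefficients with $k\ge1$ and lag $i\ge 1$ are bounded in absolute value by $|f_i|$; (ii) $y$ and $u$ are quasi-stationary, i.e. for $x=y$ and $x=u$ the quantities $\mathbb E[x_k]$ and $\mathbb E[x_ix_j]$ ($i,j,k\ge1$) exist and are bounded and $\bar{\mathbb E}[\{x_kx_{k-\tau}\}]$ exists for every $\tau\in\mathbb Z$, and $\bar{\mathbb E}[\{y_ku_{k-\tau}\}]$ exists for every $\tau\in\mathbb Z$; (iii) the matrix $\bar{\mathbb E}[\{\phi_k\phi_k^T\}]$ is positive definite. **Assumption 2.** All complex zeros of $z^m+a_1z^{m-1}+\dots+a_m$ satisfy $|z|<1$. **Assumption 3.** $d_1,d_2,\dots$ are independent Gaussian random variables with zero mean and variance $\delta_d^2$, and, for each $k\ge1$, $d_k$ is independent of the past data $(u_0,y_1,u_1,\dots,y_{k-1},u_{k-1})$.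 **RLS-SA algorithm.** Let $P_0\in\mathbb R^{N\times N}$ be positive definite, $\hat\theta_0^{\rm RLS},\hat\theta_0\in\mathbb R^N$, $1/2<\alpha<1$ and $0<\underline\beta\le\beta_k\le\bar\beta<\infty$, all deterministic. For $k\ge 1$ let $a_k^{\rm gain}=(1+\phi_k^TP_{k-1}\phi_k)^{-1}$, $$\hat\theta^{\rm RLS}_k=\hat\theta^{\rm RLS}_{k-1}+a_k^{\rm gain}P_{k-1}\phi_k\big(y_k-\phi_k^T\hat\theta^{\rm RLS}_{k-1}\big),\qquad P_k=P_{k-1}-a_k^{\rm gain}P_{k-1}\phi_k\phi_k^TP_{k-1},$$ let $x_k$ be the standard unit vector with number $(k\bmod N)+1$, let $s_k=1$ if $x_k^T\hat\theta^{\rm RLS}_k>x_k^T\hat\theta_{k-1}$ and $s_k=-1$ otherwise, and let $$\hat\theta_k=\hat\theta_{k-1}+\beta_kx_k\frac{s_k}{k^\alpha}.$$ **Theorem.** Under Assumptions 1–3, for every positive integer $p$, $\mathbb E\|\hat\theta_k-\theta\|^p$ is finite for every $k$, $\hat\theta_k\to\theta$ in $L^p$, and $$\mathbb E\big[\|\hat\theta_k-\theta\|^p\big]=O\!\left(\frac1{k^{p/2}}\right)\qquad(k\to\infty),$$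 where $\|\cdot\|$ is the Euclidean norm. -/

import Mathlib

open MeasureTheory ProbabilityTheory Filter Topology

open scoped NNReal Matrix

namespace RLSSA

/-! Signals are indexed by `ℤ`, so that values at nonpositive times can be referred to.
Vectors of length `m + n` list the `m` autoregressive entries first, then the `n` input entries. -/

/-- `[-y_{k-1}, …, -y_{k-m}, u_{k-1}, …, u_{k-n}]`, along one sample path. -/
def regressor (m n : ℕ) (y u : ℤ → ℝ) (k : ℕ) : Fin (m + n) → ℝ :=
  Fin.append (fun i : Fin m => -y ((k : ℤ) - 1 - (i : ℕ)))
    (fun j : Fin n => u ((k : ℤ) - 1 - (j : ℕ)))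

/-- `[a_1, …, a_m, b_1, …, b_n]`. -/
def param {m n : ℕ} (a : Fin m → ℝ) (b : Fin n → ℝ) : Fin (m + n) → ℝ :=
  Fin.append a b

section Algorithm

variable {N : ℕ}

/-- `(1 + φᵀ P φ)⁻¹`. -/
noncomputable def gain (P : Matrix (Fin N) (Fin N) ℝ) (φ : Fin N → ℝ) : ℝ :=
  (1 + φ ⬝ᵥ (P *ᵥ φ))⁻¹

/-- `P_k = P_{k-1} - a_k P_{k-1} φ_k φ_kᵀ P_{k-1}`. -/
noncomputable def covMat (φ : ℕ → Fin N → ℝ) (P₀ : Matrix (Fin N) (Fin N) ℝ) :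
    ℕ → Matrix (Fin N) (Fin N) ℝ
  | 0 => P₀
  | k + 1 =>
    covMat φ P₀ k - gain (covMat φ P₀ k) (φ (k + 1)) •
      (covMat φ P₀ k * Matrix.vecMulVec (φ (k + 1)) (φ (k + 1)) * covMat φ P₀ k)

/-- The recursive least-squares estimate
`θ_k = θ_{k-1} + a_k P_{k-1} φ_k (y_k - φ_kᵀ θ_{k-1})`. -/
noncomputable def rlsEst (φ : ℕ → Fin N → ℝ) (y : ℤ → ℝ)
    (P₀ : Matrix (Fin N) (Fin N) ℝ) (θ₀ : Fin N → ℝ) : ℕ → Fin N → ℝ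
  | 0 => θ₀
  | k + 1 =>
    rlsEst φ y P₀ θ₀ k +
      (gain (covMat φ P₀ k) (φ (k + 1)) *
        (y ((k + 1 : ℕ) : ℤ) - φ (k + 1) ⬝ᵥ rlsEst φ y P₀ θ₀ k)) •
        (covMat φ P₀ k *ᵥ φ (k + 1))

/-- The unit vector that selects the component of (zero-based) index `k mod N`. -/
def direction [NeZero N] (k : ℕ) : Fin N → ℝ :=
  Pi.single (Fin.ofNat N k) 1

/-- The transmitted bit: `1` if `xᵀ θ > xᵀ θ'`, and `-1` if `xᵀ θ ≤ xᵀ θ'`. -/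
noncomputable def oneBit (x θ θ' : Fin N → ℝ) : ℝ :=
  if x ⬝ᵥ θ > x ⬝ᵥ θ' then 1 else -1

/-- The remote estimate `θ̂_k = θ̂_{k-1} + β_k x_k s_k / k ^ α`, where `s_k` compares the local
estimate `θloc k` with `θ̂_{k-1}` in the direction `x_k`. -/
noncomputable def remoteEst [NeZero N] (θloc : ℕ → Fin N → ℝ) (α : ℝ) (β : ℕ → ℝ)
    (θ₀ : Fin N → ℝ) : ℕ → Fin N → ℝ
  | 0 => θ₀
  | k + 1 =>
    remoteEst θloc α β θ₀ k +
      (β (k + 1) *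
        (oneBit (direction (k + 1)) (θloc (k + 1)) (remoteEst θloc α β θ₀ k) /
          ((k + 1 : ℕ) : ℝ) ^ α)) • direction (k + 1)

end Algorithm

/-- The remote estimate of the RLS-SA algorithm run on the output path `y` and input path `u`. -/
noncomputable def rlssa (m n : ℕ) [NeZero (m + n)] (P₀ : Matrix (Fin (m + n)) (Fin (m + n)) ℝ)
    (θRLS₀ θ₀ : Fin (m + n) → ℝ) (α : ℝ) (β : ℕ → ℝ) (y u : ℤ → ℝ) (k : ℕ) :
    EuclideanSpace ℝ (Fin (m + n)) :=
  WithLp.toLp 2 (remoteEst (rlsEst (regressor m n y u) y P₀ θRLS₀) α β θ₀ k)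

section Assumptions

variable {Ω : Type*} [MeasurableSpace Ω]

/-- `lim_{K → ∞} (1/K) ∑_{l=1}^K E[x_l]` exists and equals `L`. -/
def HasMeanExpectation (μ : Measure Ω) (x : ℕ → Ω → ℝ) (L : ℝ) : Prop :=
  Tendsto (fun K : ℕ => (1 / (K : ℝ)) * ∑ l ∈ Finset.Icc 1 K, ∫ ω, x l ω ∂μ) atTop (𝓝 L)

/-- Existence of the (cross-)covariance function
`lim_{K → ∞} (1/K) ∑_{l=1}^K E[x_l z_{l-τ}]`, `τ ∈ ℤ`. -/
def HasCovarianceFunction (μ : Measure Ω) (x z : ℤ → Ω → ℝ) : Prop :=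
  ∀ τ : ℤ, ∃ R : ℝ, HasMeanExpectation μ (fun l ω => x (l : ℤ) ω * z ((l : ℤ) - τ) ω) R

/-- Quasi-stationary process. -/
def IsQuasiStationary (μ : Measure Ω) (x : ℤ → Ω → ℝ) : Prop :=
  (∃ C : ℝ,
    (∀ k : ℤ, 1 ≤ k → Integrable (x k) μ ∧ |∫ ω, x k ω ∂μ| < C) ∧
    (∀ i j : ℤ, 1 ≤ i → 1 ≤ j →
      Integrable (fun ω => x i ω * x j ω) μ ∧ |∫ ω, x i ω * x j ω ∂μ| < C)) ∧
  HasCovarianceFunction μ x x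

/-- A family `e k c` (time `k`, channel `c`) of independent random variables with zero mean,
variance `δ ^ 2`, and bounded moments of every positive integer order. -/
structure IsDrivingNoise {q : ℕ} (μ : Measure Ω) (e : ℕ → Fin q → Ω → ℝ) (δ : ℝ) : Prop where
  measurable : ∀ k c, Measurable (e k c)
  indep : iIndepFun (fun kc : ℕ × Fin q => e kc.1 kc.2) μ
  mean : ∀ k c, ∫ ω, e k c ω ∂μ = 0
  variance : ∀ k c, ProbabilityTheory.variance (e k c) μ = δ ^ 2
  moments : ∀ p : ℕ, 1 ≤ p → ∃ C : ℝ, ∀ k c,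
    Integrable (fun ω => |e k c ω| ^ p) μ ∧ ∫ ω, |e k c ω| ^ p ∂μ ≤ C

/-- The data are produced by a bounded deterministic sequence `r` and a driving noise `e`, both
starting at time `0`, through a uniformly stable family of filters. In `f k i` and `h k c i`, `k` is
the current time and `i` is the lag. -/
def GeneratedByStableFilters (μ : Measure Ω) (y u : ℤ → Ω → ℝ) : Prop :=
  ∃ (q : ℕ) (r : ℕ → ℝ) (e : ℕ → Fin q → Ω → ℝ) (δ : ℝ)
    (fy fu : ℕ → ℕ → ℝ) (hy hu : ℕ → Fin q → ℕ → ℝ) (g : ℕ → ℝ),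
    (∃ C : ℝ, ∀ k, |r k| ≤ C) ∧
    IsDrivingNoise μ e δ ∧
    (∀ k : ℕ, 1 ≤ k → ∀ ω, y (k : ℤ) ω =
      ∑ i ∈ Finset.Icc 1 k, fy k i * r (k - i) +
      ∑ i ∈ Finset.Icc 0 k, ∑ c, hy k c i * e (k - i) c ω) ∧
    (∀ k : ℕ, ∀ ω, u (k : ℤ) ω =
      ∑ i ∈ Finset.Icc 0 k, fu k i * r (k - i) +
      ∑ i ∈ Finset.Icc 0 k, ∑ c, hu k c i * e (k - i) c ω) ∧
    (∀ k i : ℕ, 1 ≤ k → 1 ≤ i →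
      |fy k i| ≤ |g i| ∧ |fu k i| ≤ |g i| ∧ ∀ c, |hy k c i| ≤ |g i| ∧ |hu k c i| ≤ |g i|) ∧
    Summable (fun i => |g i|)

/-- The limit of `(1/K) ∑_{l=1}^K E[φ_l φ_lᵀ]` exists and is positive definite. -/
def PersistentlyExciting (μ : Measure Ω) (m n : ℕ) (y u : ℤ → Ω → ℝ) : Prop :=
  ∃ R : Matrix (Fin (m + n)) (Fin (m + n)) ℝ, R.PosDef ∧
    ∀ i j, HasMeanExpectation μ
      (fun l ω => regressor m n (fun t => y t ω) (fun t => u t ω) l i *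
        regressor m n (fun t => y t ω) (fun t => u t ω) l j) (R i j)

/-- The standing assumption on the input and output data. -/
structure DataAssumption (μ : Measure Ω) (m n : ℕ) (y u : ℤ → Ω → ℝ) : Prop where
  generated : GeneratedByStableFilters μ y u
  quasiStationary_output : IsQuasiStationary μ y
  quasiStationary_input : IsQuasiStationary μ u
  crossCovariance : HasCovarianceFunction μ y u
  excitation : PersistentlyExciting μ m n y u

/-- The system `A(q) y_k = B(q) u_k + d_k`, `k ≥ 1`, with `A(q) = 1 + a_1 q⁻¹ + ⋯ + a_m q⁻ᵐ` and
`B(q) = b_1 q⁻¹ + ⋯ + b_n q⁻ⁿ`, started with `y_k = 0` for `k ≤ 0` and `u_k = 0` for `k < 0`. -/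
structure IsARXSystem {m n : ℕ} (a : Fin m → ℝ) (b : Fin n → ℝ) (y u : ℤ → Ω → ℝ)
    (d : ℕ → Ω → ℝ) : Prop where
  output_zero : ∀ k : ℤ, k ≤ 0 → ∀ ω, y k ω = 0
  input_zero : ∀ k : ℤ, k < 0 → ∀ ω, u k ω = 0
  equation : ∀ k : ℕ, 1 ≤ k → ∀ ω,
    y (k : ℤ) ω + ∑ i : Fin m, a i * y ((k : ℤ) - 1 - (i : ℕ)) ω =
      ∑ j : Fin n, b j * u ((k : ℤ) - 1 - (j : ℕ)) ω + d k ω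

/-- All zeros of `z ^ m A(z) = z ^ m + a_1 z ^ (m-1) + ⋯ + a_m` lie strictly inside the unit
circle, that is, `1 / A(q)` has no pole on or outside it. -/
def IsStablePolynomial {m : ℕ} (a : Fin m → ℝ) : Prop :=
  ∀ z : ℂ, z ^ m + ∑ i : Fin m, (a i : ℂ) * z ^ (m - 1 - (i : ℕ)) = 0 → ‖z‖ < 1

/-- The σ-algebra of the data `u_0, y_1, u_1, …, y_{k-1}, u_{k-1}` available before time `k`. -/
@[reducible] def pastData (y u : ℤ → Ω → ℝ) (k : ℕ) : MeasurableSpace Ω :=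
  ⨆ l ∈ Finset.range k,
    MeasurableSpace.comap (y (l : ℤ)) inferInstance ⊔
      MeasurableSpace.comap (u (l : ℤ)) inferInstance

/-- Independent Gaussian observation noise with zero mean and variance `δ ^ 2`; as observation
noise, `d_k` is independent of the data recorded before time `k`. -/
structure IsGaussianObservationNoise (μ : Measure Ω) (y u : ℤ → Ω → ℝ) (d : ℕ → Ω → ℝ)
    (δ : ℝ≥0) : Prop where
  indep : iIndepFun (fun k : ℕ => d (k + 1)) μ
  law : ∀ k : ℕ, 1 ≤ k → HasLaw (d k) (gaussianReal 0 (δ ^ 2)) μ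
  indep_past : ∀ k : ℕ, 1 ≤ k →
    Indep (MeasurableSpace.comap (d k) inferInstance) (pastData y u k) μ

end Assumptions

end RLSSA

/-! The local least-squares error is of order `1/√k` in every `L^p`, and the one-bit remote estimate
tracks the local one closely enough to keep this order. All estimates are phrased through
`HasMomentRate`, which bounds all `L^p` norms at once, so that Hölder's inequality makes rates
multiply.

Local estimate. With `Λ₀ = P₀⁻¹` and `G_k` the sum of `φ_l φ_lᵀ`, the recursion satisfies `(Λ₀ +
G_k)(θ_k - θ) = Λ₀(θ_0 - θ) + ∑ d_l φ_l`. The noise sum is a martingale of size `√k`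
(`hasMomentRate_sum_noise_mul`). The entries of `G_k` deviate from their means by `O(√k)`: the
outputs and inputs are stable filters of independent noise, and exposing the noise variables one at
a time turns the centred quadratic form into a sum of orthogonal increments
(`quadratic_moment_bound`). Both bounds come from one elementary moment inequality,
`integral_add_pow_even_le`. Since the averaged means converge to a positive definite matrix, `Λ₀ +
G_k` is bounded below by a multiple of `k` unless the fluctuation is of order `k`; on that rare
event `Λ₀` alone gives a constant bound on the inverse, paid for by the squared relative fluctuation
(`exists_information_lower_bound`). Hence the error is `O(1/√k)` and one update is `O(1/k)`
(`hasMomentRate_rlsEst`).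

Remote estimate. In each coordinate a step either reduces the error by the full step size or leaves
it at most the local error plus the step size. So the error at time `k` is at most the local error
plus the step size (or the initial error) at some earlier time `j`, minus all steps taken since. If
`k - j ≤ √k`, the local error has drifted by at most `√k` updates of size `1/k`. If `k - j > √k`,
the accumulated steps exceed the typical local error at time `j` by a power of `k`, since `α < 1`; a
Markov-type power bound makes the sum over all such `j` negligible (`abs_remoteEst_sub_le`,
`hasMomentRate_remoteEst`). -/

namespace RLSSA

/-! ### Calculus of uniform `L^p` rates. -/

section MomentRates

variable {Ω : Type*} [MeasurableSpace Ω] {μ : Measure Ω} {ι κ : Type*}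

/-- Every `L^p` norm of `X i` is at most a constant multiple of `f i`, uniformly in `i`. -/
def HasMomentRate (μ : Measure Ω) (X : ι → Ω → ℝ) (f : ι → ℝ) : Prop :=
  ∀ p : ℕ, ∃ C : ℝ, 0 ≤ C ∧ ∀ i,
    AEStronglyMeasurable (X i) μ ∧ eLpNorm (X i) p μ ≤ ENNReal.ofReal (C * f i)

namespace HasMomentRate

variable {X Y : ι → Ω → ℝ} {f g : ι → ℝ}

theorem aesm (hX : HasMomentRate μ X f) (i : ι) : AEStronglyMeasurable (X i) μ :=
  ((hX 1).choose_spec.2 i).1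

theorem memLp (hX : HasMomentRate μ X f) (i : ι) (p : ℕ) : MemLp (X i) p μ := by
  obtain ⟨C, -, h⟩ := hX p
  exact ⟨(h i).1, (h i).2.trans_lt ENNReal.ofReal_lt_top⟩

theorem memLp_two (hX : HasMomentRate μ X f) (i : ι) : MemLp (X i) 2 μ := by
  simpa using hX.memLp i 2

theorem integrable (hX : HasMomentRate μ X f) (i : ι) : Integrable (X i) μ := by
  have := hX.memLp i 1
  rw [Nat.cast_one] at this
  exact memLp_one_iff_integrable.1 this

theorem add (hX : HasMomentRate μ X f) (hY : HasMomentRate μ Y f) (hf : ∀ i, 0 ≤ f i) :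
    HasMomentRate μ (fun i ω => X i ω + Y i ω) f := by
  intro p
  obtain ⟨C, hC, h⟩ := hX p
  obtain ⟨D, hD, h'⟩ := hY p
  refine ⟨C + D, by positivity, fun i => ⟨(h i).1.add (h' i).1, ?_⟩⟩
  rcases Nat.eq_zero_or_pos p with rfl | hp
  · simp
  have hp1 : (1 : ENNReal) ≤ p := by exact_mod_cast hp
  refine (eLpNorm_add_le (h i).1 (h' i).1 hp1).trans ?_
  rw [add_mul, ENNReal.ofReal_add (mul_nonneg hC (hf i)) (mul_nonneg hD (hf i))]
  exact add_le_add (h i).2 (h' i).2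

theorem of_weight_le (hX : HasMomentRate μ X f) {c : ℝ} (hc : 0 ≤ c)
    (hfg : ∀ i, f i ≤ c * g i) : HasMomentRate μ X g := by
  intro p
  obtain ⟨C, hC, h⟩ := hX p
  refine ⟨C * c, by positivity, fun i => ⟨(h i).1, (h i).2.trans (ENNReal.ofReal_le_ofReal ?_)⟩⟩
  rw [mul_assoc]
  exact mul_le_mul_of_nonneg_left (hfg i) hC

theorem of_abs_le (hX : HasMomentRate μ X f) (hY : ∀ i, AEStronglyMeasurable (Y i) μ)
    (h : ∀ i, ∀ᵐ ω ∂μ, |Y i ω| ≤ |X i ω|) : HasMomentRate μ Y f := by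
  intro p
  obtain ⟨C, hC, hb⟩ := hX p
  exact ⟨C, hC, fun i => ⟨hY i, (eLpNorm_mono_ae (h i)).trans (hb i).2⟩⟩

theorem congr (hX : HasMomentRate μ X f) (h : ∀ i, X i =ᵐ[μ] Y i) : HasMomentRate μ Y f :=
  hX.of_abs_le (fun i => (hX.aesm i).congr (h i))
    fun i => (h i).mono fun ω hω => by rw [hω]

theorem abs (hX : HasMomentRate μ X f) : HasMomentRate μ (fun i ω => |X i ω|) f :=
  hX.of_abs_le (fun i => (hX.aesm i).norm) fun i => ae_of_all _ fun ω => by simp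

theorem comp (hX : HasMomentRate μ X f) (σ : κ → ι) :
    HasMomentRate μ (fun k => X (σ k)) (fun k => f (σ k)) := by
  intro p
  obtain ⟨C, hC, h⟩ := hX p
  exact ⟨C, hC, fun k => h (σ k)⟩

theorem of_le_const [IsProbabilityMeasure μ] {c : ι → ℝ} {C : ℝ} (hC : 0 ≤ C)
    (h : ∀ i, |c i| ≤ C * f i) : HasMomentRate μ (fun i _ => c i) f := by
  intro p
  refine ⟨C, hC, fun i => ⟨aestronglyMeasurable_const, ?_⟩⟩
  refine (eLpNorm_le_of_ae_bound (C := C * f i) (ae_of_all _ fun _ => h i)).trans ?_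
  simp

/-- Hölder with exponents `2p, 2p` costs a doubling of the exponent; this is why a rate is required
for all `p` simultaneously. -/
theorem mul (hX : HasMomentRate μ X f) (hY : HasMomentRate μ Y g) (hf : ∀ i, 0 ≤ f i) :
    HasMomentRate μ (fun i ω => X i ω * Y i ω) (fun i => f i * g i) := by
  intro p
  obtain ⟨C, hC, h⟩ := hX (2 * p)
  obtain ⟨D, hD, h'⟩ := hY (2 * p)
  refine ⟨C * D, by positivity, fun i => ⟨(h i).1.mul (h' i).1, ?_⟩⟩
  have : ENNReal.HolderTriple ((2 * p : ℕ) : ENNReal) ((2 * p : ℕ) : ENNReal) (p : ENNReal) := by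
    constructor
    push_cast
    rw [ENNReal.mul_inv (Or.inl (by norm_num)) (Or.inl (by norm_num)), ← add_mul,
      ENNReal.inv_two_add_inv_two, one_mul]
  refine (eLpNorm_smul_le_mul_eLpNorm (p := ((2 * p : ℕ) : ENNReal)) (q := ((2 * p : ℕ) : ENNReal))
    (h' i).1 (h i).1).trans ?_
  rw [show C * D * (f i * g i) = (C * f i) * (D * g i) by ring,
    ENNReal.ofReal_mul (mul_nonneg hC (hf i))]
  exact mul_le_mul' (h i).2 (h' i).2

theorem const_mul (hX : HasMomentRate μ X f) (c : ℝ) :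
    HasMomentRate μ (fun i ω => c * X i ω) f := by
  intro p
  obtain ⟨C, hC, h⟩ := hX p
  refine ⟨|c| * C, by positivity, fun i => ⟨(h i).1.const_mul c, ?_⟩⟩
  have := eLpNorm_const_smul c (X i) (p : ENNReal) μ
  rw [Real.enorm_eq_ofReal_abs] at this
  refine this.trans_le ?_
  rw [mul_assoc, ENNReal.ofReal_mul (abs_nonneg c)]
  exact mul_le_mul_right (h i).2 _

theorem weight_mul [IsProbabilityMeasure μ] (hX : HasMomentRate μ X f) (c : ι → ℝ) :
    HasMomentRate μ (fun i ω => c i * X i ω) (fun i => |c i| * f i) :=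
  (of_le_const (f := fun i => |c i|) (C := 1) zero_le_one (fun i => by simp)).mul hX
    fun i => abs_nonneg _

theorem pow [IsProbabilityMeasure μ] (hX : HasMomentRate μ X f) (hf : ∀ i, 0 ≤ f i) (n : ℕ) :
    HasMomentRate μ (fun i ω => X i ω ^ n) (fun i => f i ^ n) := by
  induction n with
  | zero =>
    simpa using of_le_const (μ := μ) (f := fun _ : ι => (1 : ℝ)) (c := fun _ => 1) (C := 1)
      zero_le_one (fun i => by simp)
  | succ n ih => simpa only [pow_succ] using ih.mul hX fun i => pow_nonneg (hf i) n

/-- The triangle inequality for sums whose weights have bounded total. -/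
theorem sum_of_le {X : κ → ι → Ω → ℝ} {f : κ → ι → ℝ} {J : κ → Finset ι}
    (hX : HasMomentRate μ (fun x : κ × ι => X x.1 x.2) (fun x => f x.1 x.2))
    (hf : ∀ k i, 0 ≤ f k i) {F : κ → ℝ} {C : ℝ} (hC : 0 ≤ C)
    (h : ∀ k, ∑ i ∈ J k, f k i ≤ C * F k) :
    HasMomentRate μ (fun k ω => ∑ i ∈ J k, X k i ω) F := by
  intro p
  obtain ⟨D, hD, hb⟩ := hX p
  refine ⟨D * C, by positivity, fun k => ⟨?_, ?_⟩⟩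
  · exact Finset.aestronglyMeasurable_fun_sum _ fun i _ => (hb (k, i)).1
  rcases Nat.eq_zero_or_pos p with rfl | hp
  · simp
  have hp1 : (1 : ENNReal) ≤ p := by exact_mod_cast hp
  have := eLpNorm_sum_le (μ := μ) (f := X k) (s := J k) (fun i _ => (hb (k, i)).1) hp1
  rw [show (∑ i ∈ J k, X k i) = fun ω => ∑ i ∈ J k, X k i ω by ext; simp] at this
  refine this.trans ((Finset.sum_le_sum fun i _ => (hb (k, i)).2).trans ?_)
  rw [← ENNReal.ofReal_sum_of_nonneg fun i _ => mul_nonneg hD (hf k i), ← Finset.mul_sum]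
  refine ENNReal.ofReal_le_ofReal ?_
  rw [mul_assoc]
  exact mul_le_mul_of_nonneg_left (h k) hD

theorem finset_sum [IsProbabilityMeasure μ] {X : κ → ι → Ω → ℝ} (J : Finset κ)
    (hX : ∀ j ∈ J, HasMomentRate μ (X j) f)
    (hf : ∀ i, 0 ≤ f i) : HasMomentRate μ (fun i ω => ∑ j ∈ J, X j i ω) f := by
  classical
  induction J using Finset.induction_on with
  | empty =>
    simpa using of_le_const (μ := μ) (f := f) (c := fun _ => 0) (C := 0) le_rfl
      (fun i => by simp)
  | insert a s ha ih =>
    simp only [Finset.sum_insert ha]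
    exact (hX a (Finset.mem_insert_self _ _)).add
      (ih fun j hj => hX j (Finset.mem_insert_of_mem hj)) hf

theorem integral_pow_le (hX : HasMomentRate μ X f) (hf : ∀ i, 0 ≤ f i) {p : ℕ} (hp : 1 ≤ p) :
    ∃ C : ℝ, 0 ≤ C ∧ ∀ i, ∫ ω, |X i ω| ^ p ∂μ ≤ C * f i ^ p := by
  obtain ⟨C, hC, h⟩ := hX p
  refine ⟨C ^ p, by positivity, fun i => ?_⟩
  have h1 := (h i).2
  rw [(hX.memLp i p).eLpNorm_eq_integral_rpow_norm (by simp; omega) (by simp),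
    ENNReal.ofReal_le_ofReal_iff (mul_nonneg hC (hf i))] at h1
  simp only [ENNReal.toReal_natCast, Real.rpow_natCast, Real.norm_eq_abs] at h1
  have h0 : 0 ≤ ∫ ω, |X i ω| ^ p ∂μ := integral_nonneg fun ω => by positivity
  calc ∫ ω, |X i ω| ^ p ∂μ = ((∫ ω, |X i ω| ^ p ∂μ) ^ (p : ℝ)⁻¹) ^ p :=
        (Real.rpow_inv_natCast_pow h0 (by omega)).symm
    _ ≤ (C * f i) ^ p := pow_le_pow_left₀ (Real.rpow_nonneg h0 _) h1 p
    _ = C ^ p * f i ^ p := mul_pow _ _ _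

/-- On a probability space `L^p` norms increase with `p`, so even exponents suffice, and these avoid
absolute values in binomial expansions. -/
theorem of_integral_even_pow_le [IsProbabilityMeasure μ] (hf : ∀ i, 0 ≤ f i)
    (hX : ∀ i (p : ℕ), MemLp (X i) p μ)
    (h : ∀ m : ℕ, 1 ≤ m → ∃ C : ℝ, ∀ i, ∫ ω, X i ω ^ (2 * m) ∂μ ≤ C * f i ^ (2 * m)) :
    HasMomentRate μ X f := by
  intro p
  -- `p + 1` rather than `p`, so that the case `p = 0` also gets an admissible exponent.
  obtain ⟨C, hC⟩ := h (p + 1) (by omega)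
  refine ⟨(max C 0) ^ ((2 * (p + 1) : ℕ) : ℝ)⁻¹, by positivity, fun i => ⟨(hX i p).1, ?_⟩⟩
  have hle : (p : ENNReal) ≤ ((2 * (p + 1) : ℕ) : ENNReal) := by
    exact_mod_cast (by omega : p ≤ 2 * (p + 1))
  refine (eLpNorm_le_eLpNorm_of_exponent_le hle (hX i p).1).trans ?_
  rw [(hX i _).eLpNorm_eq_integral_rpow_norm (by simp) (ENNReal.natCast_ne_top _)]
  refine ENNReal.ofReal_le_ofReal ?_
  simp only [ENNReal.toReal_natCast, Real.rpow_natCast, Real.norm_eq_abs]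
  simp_rw [(even_two_mul (p + 1)).pow_abs]
  have h0 : 0 ≤ ∫ ω, X i ω ^ (2 * (p + 1)) ∂μ :=
    integral_nonneg fun ω => (even_two_mul (p + 1)).pow_nonneg _
  calc (∫ ω, X i ω ^ (2 * (p + 1)) ∂μ) ^ ((2 * (p + 1) : ℕ) : ℝ)⁻¹
      ≤ (max C 0 * f i ^ (2 * (p + 1))) ^ ((2 * (p + 1) : ℕ) : ℝ)⁻¹ := by
        refine Real.rpow_le_rpow h0 ((hC i).trans ?_) (by positivity)
        exact mul_le_mul_of_nonneg_right (le_max_left _ _) (pow_nonneg (hf i) _)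
    _ = _ := by
        rw [Real.mul_rpow (le_max_right _ _) (pow_nonneg (hf i) _),
          Real.pow_rpow_inv_natCast (hf i) (by omega)]

theorem of_forall_memLp [IsProbabilityMeasure μ] {Z : Ω → ℝ} (h : ∀ p : ℕ, MemLp Z p μ) :
    HasMomentRate μ (fun _ : κ => Z) (fun _ => 1) := by
  intro p
  refine ⟨(eLpNorm Z p μ).toReal, ENNReal.toReal_nonneg, fun _ => ⟨(h p).1, ?_⟩⟩
  rw [mul_one, ENNReal.ofReal_toReal (h p).2.ne]

end HasMomentRate

end MomentRates

/-! ### Random variables with moments of all orders. -/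

section AllMoments

variable {Ω : Type*} [MeasurableSpace Ω] {μ : Measure Ω} [IsProbabilityMeasure μ]

theorem memLp_mul_of_forall {S D : Ω → ℝ} (hS : ∀ p : ℕ, MemLp S p μ) (hD : ∀ p : ℕ, MemLp D p μ)
    (p : ℕ) : MemLp (fun ω => S ω * D ω) p μ :=
  ((HasMomentRate.of_forall_memLp (κ := Unit) hS).mul (HasMomentRate.of_forall_memLp hD)
    fun _ => zero_le_one).memLp () p

theorem memLp_pow_of_forall {S : Ω → ℝ} (hS : ∀ p : ℕ, MemLp S p μ) (n p : ℕ) :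
    MemLp (fun ω => S ω ^ n) p μ :=
  ((HasMomentRate.of_forall_memLp (κ := Unit) hS).pow (fun _ => zero_le_one) n).memLp () p

theorem integrable_of_forall_memLp {S : Ω → ℝ} (hS : ∀ p : ℕ, MemLp S p μ) : Integrable S μ :=
  (HasMomentRate.of_forall_memLp (κ := Unit) hS).integrable ()

end AllMoments

/-! ### Moment growth of sums of orthogonal increments. -/

section Martingale

/-- In the binomial expansion, every term with at least two factors `d` is dominated by `s ^ (2m-2)
* d ^ 2` if `|d| ≤ |s|` and by `d ^ (2m)` otherwise; the coefficients sum to at most `2 ^ (2m)`. The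
linear term is kept exact because orthogonality will remove it. -/
theorem add_pow_even_le (m : ℕ) (hm : 1 ≤ m) (s d : ℝ) :
    (s + d) ^ (2 * m) ≤ s ^ (2 * m) + 2 * m * (s ^ (2 * m - 1) * d) +
      2 ^ (2 * m) * (s ^ (2 * m - 2) * d ^ 2 + d ^ (2 * m)) := by
  obtain ⟨n, rfl⟩ : ∃ n, m = n + 1 := ⟨m - 1, by omega⟩
  have hB : 0 ≤ s ^ (2 * n) * d ^ 2 + d ^ (2 * (n + 1)) :=
    add_nonneg (mul_nonneg ((even_two_mul n).pow_nonneg _) (sq_nonneg _))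
      ((even_two_mul (n + 1)).pow_nonneg _)
  have hterm : ∀ j ∈ Finset.range (2 * n + 1),
      s ^ j * d ^ (2 * n + 2 - j) * ((2 * n + 2).choose j : ℝ) ≤
        ((2 * n + 2).choose j : ℝ) * (s ^ (2 * n) * d ^ 2 + d ^ (2 * (n + 1))) := by
    intro j hj
    have hj' : j ≤ 2 * n := by simpa [Nat.lt_succ_iff] using hj
    rw [mul_comm]
    refine mul_le_mul_of_nonneg_left ?_ (by positivity)
    have h1 : s ^ j * d ^ (2 * n + 2 - j) ≤ |s| ^ j * |d| ^ (2 * n + 2 - j) := by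
      rw [← abs_pow, ← abs_pow, ← abs_mul]
      exact le_abs_self _
    have e1 : s ^ (2 * n) = |s| ^ (2 * n) := ((even_two_mul n).pow_abs s).symm
    have e2 : d ^ (2 * (n + 1)) = |d| ^ (2 * (n + 1)) := ((even_two_mul (n + 1)).pow_abs d).symm
    rw [e1, e2, ← sq_abs d]
    refine h1.trans ?_
    rcases le_total |d| |s| with h | h
    · have : |s| ^ j * |d| ^ (2 * n + 2 - j) ≤ |s| ^ (2 * n) * |d| ^ 2 := by
        rw [show 2 * n + 2 - j = (2 * n - j) + 2 by omega, pow_add |d|, ← mul_assoc]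
        refine mul_le_mul_of_nonneg_right ?_ (by positivity)
        calc |s| ^ j * |d| ^ (2 * n - j) ≤ |s| ^ j * |s| ^ (2 * n - j) := by gcongr
          _ = |s| ^ (2 * n) := by rw [← pow_add]; congr 1; omega
      exact this.trans (le_add_of_nonneg_right (by positivity))
    · have : |s| ^ j * |d| ^ (2 * n + 2 - j) ≤ |d| ^ (2 * (n + 1)) := by
        calc |s| ^ j * |d| ^ (2 * n + 2 - j) ≤ |d| ^ j * |d| ^ (2 * n + 2 - j) := by gcongr
          _ = |d| ^ (2 * (n + 1)) := by rw [← pow_add]; congr 1; omega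
      exact this.trans (le_add_of_nonneg_left (by positivity))
  have hsum := Finset.sum_le_sum hterm
  rw [← Finset.sum_mul] at hsum
  have hch : ∑ j ∈ Finset.range (2 * n + 1), ((2 * n + 2).choose j : ℝ) ≤ 2 ^ (2 * (n + 1)) := by
    have h2 : ∑ j ∈ Finset.range (2 * n + 2 + 1), ((2 * n + 2).choose j : ℝ) = 2 ^ (2 * n + 2) := by
      exact_mod_cast Nat.sum_range_choose (2 * n + 2)
    rw [show 2 * (n + 1) = 2 * n + 2 by ring, ← h2]
    exact Finset.sum_le_sum_of_subset_of_nonneg (by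
      intro x hx; simp only [Finset.mem_range] at *; omega) fun _ _ _ => by positivity
  have hch' := mul_le_mul_of_nonneg_right hch hB
  rw [show 2 * (n + 1) = 2 * n + 2 by ring] at *
  rw [add_pow, Finset.sum_range_succ, Finset.sum_range_succ]
  simp only [show 2 * n + 2 - (2 * n + 1) = 1 by omega, Nat.sub_self, pow_one, pow_zero, mul_one,
    Nat.choose_self, Nat.cast_one,
    show 2 * n + 2 - 1 = 2 * n + 1 by omega, Nat.add_sub_cancel]
  have e3 : ((2 * n + 2).choose (2 * n + 1) : ℝ) = 2 * n + 2 := by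
    rw [Nat.choose_succ_self_right (2 * n + 1)]; push_cast; ring
  rw [e3]
  push_cast
  nlinarith [hsum, hch']

/-- A weighted Young inequality, by comparing `n * d ^ 2` with `s ^ 2`. With `n` the number of
summands, the factor `1/n` keeps the compounded growth over `n` steps bounded. -/
theorem pow_mul_sq_le (m : ℕ) (hm : 1 ≤ m) {n : ℝ} (hn : 1 ≤ n) (s d : ℝ) :
    s ^ (2 * m - 2) * d ^ 2 ≤ s ^ (2 * m) / n + n ^ (m - 1) * d ^ (2 * m) := by
  obtain ⟨k, rfl⟩ : ∃ k, m = k + 1 := ⟨m - 1, by omega⟩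
  have e1 : s ^ (2 * (k + 1) - 2) = (s ^ 2) ^ k := by rw [← pow_mul]; congr 1
  have e2 : s ^ (2 * (k + 1)) = (s ^ 2) ^ k * s ^ 2 := by rw [← pow_mul]; ring
  have e3 : d ^ (2 * (k + 1)) = (d ^ 2) ^ k * d ^ 2 := by rw [← pow_mul]; ring
  rw [e1, e2, e3, Nat.add_sub_cancel]
  have hs := sq_nonneg s
  have hd := sq_nonneg d
  generalize s ^ 2 = A at *
  generalize d ^ 2 = B at *
  rcases le_total (n * B) A with h | h
  · have h' : B ≤ A / n := by rw [le_div_iff₀ (by linarith)]; linarith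
    have : A ^ k * B ≤ A ^ k * A / n := by rw [mul_div_assoc]; gcongr
    exact this.trans (le_add_of_nonneg_right (by positivity))
  · have : A ^ k * B ≤ n ^ k * (B ^ k * B) := by
      rw [← mul_assoc, ← mul_pow]; gcongr
    exact this.trans (le_add_of_nonneg_left (by positivity))

variable {Ω : Type*} [MeasurableSpace Ω] {μ : Measure Ω} [IsProbabilityMeasure μ]

/-- Moment growth under the addition of an increment orthogonal to `S ^ (2 m - 1)`. -/
theorem integral_add_pow_even_le {S D : Ω → ℝ} (hS : ∀ p : ℕ, MemLp S p μ)
    (hD : ∀ p : ℕ, MemLp D p μ) {m : ℕ} (hm : 1 ≤ m) {n : ℝ} (hn : 1 ≤ n)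
    (h0 : ∫ ω, S ω ^ (2 * m - 1) * D ω ∂μ = 0) :
    ∫ ω, (S ω + D ω) ^ (2 * m) ∂μ ≤ (1 + 2 ^ (2 * m) / n) * ∫ ω, S ω ^ (2 * m) ∂μ +
      2 * 2 ^ (2 * m) * n ^ (m - 1) * ∫ ω, D ω ^ (2 * m) ∂μ := by
  have hpt : ∀ ω, (S ω + D ω) ^ (2 * m) ≤ ((1 + 2 ^ (2 * m) / n) * S ω ^ (2 * m) +
      2 * 2 ^ (2 * m) * n ^ (m - 1) * D ω ^ (2 * m)) +
      2 * m * (S ω ^ (2 * m - 1) * D ω) := by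
    intro ω
    have h1 := add_pow_even_le m hm (S ω) (D ω)
    have h2 := pow_mul_sq_le m hm hn (S ω) (D ω)
    have h3 : D ω ^ (2 * m) ≤ n ^ (m - 1) * D ω ^ (2 * m) :=
      le_mul_of_one_le_left ((even_two_mul m).pow_nonneg _) (one_le_pow₀ hn)
    have h4 := mul_le_mul_of_nonneg_left (add_le_add h2 h3)
      (by positivity : (0 : ℝ) ≤ 2 ^ (2 * m))
    calc _ ≤ _ := h1
      _ ≤ _ := add_le_add_right h4 _
      _ = _ := by ring
  have iS := integrable_of_forall_memLp (memLp_pow_of_forall hS (2 * m))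
  have iD := integrable_of_forall_memLp (memLp_pow_of_forall hD (2 * m))
  have iSD := integrable_of_forall_memLp
    (memLp_mul_of_forall (memLp_pow_of_forall hS (2 * m - 1)) hD)
  have iL := integrable_of_forall_memLp
    (memLp_pow_of_forall (S := fun ω => S ω + D ω) (fun p => (hS p).add (hD p)) (2 * m))
  refine (integral_mono iL (((iS.const_mul _).add (iD.const_mul _)).add (iSD.const_mul _))
    hpt).trans_eq ?_
  rw [integral_add' ((iS.const_mul _).add (iD.const_mul _)) (iSD.const_mul _),
    integral_add' (iS.const_mul _) (iD.const_mul _), integral_const_mul, integral_const_mul,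
    integral_const_mul, h0]
  ring

theorem integral_mul_eq_zero_of_indep {Ω : Type*} {m₁ m₂ mΩ : MeasurableSpace Ω} {μ : Measure Ω}
    (h₁ : m₁ ≤ mΩ) (h₂ : m₂ ≤ mΩ) (h : Indep m₁ m₂ μ) {f g : Ω → ℝ}
    (hf : Measurable[m₁] f) (hg : Measurable[m₂] g) (hg0 : ∫ ω, g ω ∂μ = 0) :
    ∫ ω, f ω * g ω ∂μ = 0 := by
  have hi : IndepFun f g μ := by
    rw [IndepFun_iff_Indep]
    exact indep_of_indep_of_le h hf.comap_le hg.comap_le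
  have hf' : Measurable f := hf.mono h₁ le_rfl
  have hg' : Measurable g := hg.mono h₂ le_rfl
  rw [hi.integral_fun_mul_eq_mul_integral hf'.aestronglyMeasurable hg'.aestronglyMeasurable, hg0,
    mul_zero]

/-- Discrete Gronwall step: `j * b * (1 + c) ^ j` is the invariant of the inductions below. -/
theorem growth_step {x x' c b : ℝ} (j : ℕ) (hc : 0 ≤ c) (hb : 0 ≤ b)
    (hx : x ≤ j * b * (1 + c) ^ j) (h : x' ≤ (1 + c) * x + b) :
    x' ≤ ((j + 1 : ℕ) : ℝ) * b * (1 + c) ^ (j + 1) := by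
  have h1 : (1 + c) * x ≤ (1 + c) * (j * b * (1 + c) ^ j) :=
    mul_le_mul_of_nonneg_left hx (by linarith)
  have h2 : b ≤ b * (1 + c) ^ (j + 1) := le_mul_of_one_le_right hb (one_le_pow₀ (by linarith))
  push_cast
  calc x' ≤ (1 + c) * (j * b * (1 + c) ^ j) + b * (1 + c) ^ (j + 1) := by linarith
    _ = _ := by ring

/-- At most `n` steps, each adding `B * n ^ (m-1)` and multiplying by `1 + c/n`, give order `n ^ m`,
the size of the `2m`-th moment of a sum of `n` orthogonal terms. -/
theorem growth_bound {x c B : ℝ} {j n m : ℕ} (hm : 1 ≤ m) (hn : 1 ≤ n) (hj : j ≤ n) (hc : 0 ≤ c)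
    (hB : 0 ≤ B) (hx : x ≤ j * (B * (n : ℝ) ^ (m - 1)) * (1 + c / n) ^ j) :
    x ≤ B * Real.exp c * (n : ℝ) ^ m := by
  have hn' : (0 : ℝ) < n := by exact_mod_cast hn
  have h1 : (1 + c / n) ^ j ≤ Real.exp c := by
    calc (1 + c / n) ^ j ≤ (1 + c / n) ^ n :=
          pow_le_pow_right₀ (le_add_of_nonneg_right (by positivity)) hj
      _ ≤ Real.exp (c / n) ^ n := by
          refine pow_le_pow_left₀ (by positivity) ?_ n
          linarith [Real.add_one_le_exp (c / n)]
      _ = Real.exp c := by rw [← Real.exp_nat_mul]; congr 1; field_simp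
  have h2 : (j : ℝ) ≤ n := by exact_mod_cast hj
  calc x ≤ _ := hx
    _ ≤ n * (B * (n : ℝ) ^ (m - 1)) * Real.exp c := by gcongr
    _ = B * Real.exp c * ((n : ℝ) ^ (m - 1) * n) := by ring
    _ = _ := by rw [← pow_succ, Nat.sub_add_cancel hm]

end Martingale

/-! ### Concentration of quadratic forms in independent noise. -/

section LinearProcesses

variable {Ω : Type*} {ι : Type*}

/-- The finite linear combination `M l + ∑_{s ∈ J} h l s ξ_s`. -/
def affineSum (ξ : ι → Ω → ℝ) (M : ℤ → ℝ) (h : ℤ → ι → ℝ) (J : Finset ι) (l : ℤ) (ω : Ω) : ℝ :=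
  M l + ∑ s ∈ J, h l s * ξ s ω

theorem measurable_affineSum {m : MeasurableSpace Ω} {ξ : ι → Ω → ℝ} {J : Finset ι}
    (hξ : ∀ s ∈ J, Measurable (ξ s)) (M : ℤ → ℝ) (h : ℤ → ι → ℝ) (l : ℤ) :
    Measurable (affineSum ξ M h J l) :=
  measurable_const.add (Finset.measurable_fun_sum _ fun s hs => (hξ s hs).const_mul _)

theorem measurable_sum_affineSum_mul {m : MeasurableSpace Ω} {ξ : ι → Ω → ℝ} {J : Finset ι}
    (hξ : ∀ s ∈ J, Measurable (ξ s)) (M M' : ℤ → ℝ) (h h' : ℤ → ι → ℝ) (T : Finset ℤ) :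
    Measurable fun ω => ∑ l ∈ T, affineSum ξ M h J l ω * affineSum ξ M' h' J l ω :=
  Finset.measurable_fun_sum _ fun l _ =>
    (measurable_affineSum hξ M h l).mul (measurable_affineSum hξ M' h' l)

theorem measurable_sum_affineSum {m : MeasurableSpace Ω} {ξ : ι → Ω → ℝ} {J : Finset ι}
    (hξ : ∀ s ∈ J, Measurable (ξ s)) (M M' : ℤ → ℝ) (h h' : ℤ → ι → ℝ) (T : Finset ℤ) (a : ι) :
    Measurable fun ω =>
      ∑ l ∈ T, (h' l a * affineSum ξ M h J l ω + h l a * affineSum ξ M' h' J l ω) :=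
  Finset.measurable_fun_sum _ fun l _ =>
    ((measurable_affineSum hξ M h l).const_mul _).add
      ((measurable_affineSum hξ M' h' l).const_mul _)

/-- Exposing one more noise variable `ξ a` adds a term linear in it, whose coefficient involves only
the noise already exposed, and a deterministic multiple of `ξ a ω ^ 2`. After centring both are
orthogonal to the past. -/
theorem sum_affineSum_mul_insert [DecidableEq ι] (ξ : ι → Ω → ℝ) (M M' : ℤ → ℝ)
    (h h' : ℤ → ι → ℝ) (T : Finset ℤ) {J : Finset ι} {a : ι} (ha : a ∉ J) (ω : Ω) :
    ∑ l ∈ T, affineSum ξ M h (insert a J) l ω * affineSum ξ M' h' (insert a J) l ω =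
      ∑ l ∈ T, affineSum ξ M h J l ω * affineSum ξ M' h' J l ω +
      (∑ l ∈ T, (h' l a * affineSum ξ M h J l ω + h l a * affineSum ξ M' h' J l ω)) * ξ a ω +
      (∑ l ∈ T, h l a * h' l a) * ξ a ω ^ 2 := by
  rw [Finset.sum_mul, Finset.sum_mul, ← Finset.sum_add_distrib, ← Finset.sum_add_distrib]
  refine Finset.sum_congr rfl fun l _ => ?_
  simp only [affineSum, Finset.sum_insert ha]
  ring

variable [mΩ : MeasurableSpace Ω] {μ : Measure Ω}

/-- Independent centred random variables with uniformly bounded moments. -/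
structure IsNoiseFamily (μ : Measure Ω) (ξ : ι → Ω → ℝ) : Prop where
  measurable : ∀ s, Measurable (ξ s)
  indep : iIndepFun ξ μ
  mean : ∀ s, ∫ ω, ξ s ω ∂μ = 0
  moments : HasMomentRate μ ξ (fun _ => 1)

/-- Uniform bounds on the mean and on the row and column sums of a filter. -/
structure IsStableFilter (M : ℤ → ℝ) (h : ℤ → ι → ℝ) (B : ℝ) : Prop where
  mean_le : ∀ l, |M l| ≤ B
  row : ∀ l (F : Finset ι), ∑ s ∈ F, |h l s| ≤ B
  col : ∀ s (F : Finset ℤ), ∑ l ∈ F, |h l s| ≤ B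

theorem IsStableFilter.nonneg {M : ℤ → ℝ} {h : ℤ → ι → ℝ} {B : ℝ} (H : IsStableFilter M h B) :
    0 ≤ B := (abs_nonneg _).trans (H.mean_le 0)

theorem IsStableFilter.mono {M : ℤ → ℝ} {h : ℤ → ι → ℝ} {B B' : ℝ} (H : IsStableFilter M h B)
    (hB : B ≤ B') : IsStableFilter M h B' :=
  ⟨fun l => (H.mean_le l).trans hB, fun l F => (H.row l F).trans hB,
    fun s F => (H.col s F).trans hB⟩

theorem indep_comap_iSup {ξ : ι → Ω → ℝ} (hξ : IsNoiseFamily μ ξ) {J : Finset ι} {a : ι}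
    (ha : a ∉ J) :
    Indep (⨆ s ∈ (J : Set ι), MeasurableSpace.comap (ξ s) inferInstance)
      (MeasurableSpace.comap (ξ a) inferInstance) μ := by
  have := indep_iSup_of_disjoint (fun s => (hξ.measurable s).comap_le) hξ.indep.iIndep
    (S := (J : Set ι)) (T := {a}) (by simpa using ha)
  simpa using this

variable [IsProbabilityMeasure μ]

theorem hasMomentRate_affineSum {ξ : ι → Ω → ℝ} (hξ : IsNoiseFamily μ ξ) {M : ℤ → ℝ}
    {h : ℤ → ι → ℝ} {B : ℝ} (H : IsStableFilter M h B) :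
    HasMomentRate μ (fun x : Finset ι × ℤ => affineSum ξ M h x.1 x.2) (fun _ => 1) := by
  refine HasMomentRate.add (X := fun (x : Finset ι × ℤ) _ => M x.2) ?_ ?_ fun _ => zero_le_one
  · exact HasMomentRate.of_le_const H.nonneg fun x => by simpa using H.mean_le x.2
  · refine HasMomentRate.sum_of_le (X := fun (x : Finset ι × ℤ) s ω => h x.2 s * ξ s ω)
      (J := fun x => x.1) (f := fun x s => |h x.2 s| * 1) ?_ (fun _ _ => by positivity) H.nonneg ?_
    · exact (hξ.moments.comp fun x : (Finset ι × ℤ) × ι => x.2).weight_mul fun x => h x.1.2 x.2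
    · intro x
      simpa using H.row x.2 x.1

/-- The coefficient of a single noise variable stays bounded however many times `l` are summed,
because that variable has bounded total influence (column sums) on the whole trajectory. -/
theorem hasMomentRate_increment {ξ : ι → Ω → ℝ} (hξ : IsNoiseFamily μ ξ) {M M' : ℤ → ℝ}
    {h h' : ℤ → ι → ℝ} {B : ℝ} (H : IsStableFilter M h B) (H' : IsStableFilter M' h' B) :
    HasMomentRate μ (fun (x : Finset ℤ × Finset ι × ι) ω =>
      ∑ l ∈ x.1, (h' l x.2.2 * affineSum ξ M h x.2.1 l ω + h l x.2.2 * affineSum ξ M' h' x.2.1 l ω))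
      (fun _ => 1) := by
  have key : ∀ {M : ℤ → ℝ} {h g : ℤ → ι → ℝ}, IsStableFilter M h B →
      (∀ s (F : Finset ℤ), ∑ l ∈ F, |g l s| ≤ B) →
      HasMomentRate μ (fun (x : Finset ℤ × Finset ι × ι) ω =>
        ∑ l ∈ x.1, g l x.2.2 * affineSum ξ M h x.2.1 l ω) (fun _ => 1) := by
    intro M h g H hg
    refine HasMomentRate.sum_of_le
      (X := fun (x : Finset ℤ × Finset ι × ι) l ω => g l x.2.2 * affineSum ξ M h x.2.1 l ω)
      (J := fun x => x.1) (f := fun x l => |g l x.2.2| * 1) ?_ (fun _ _ => by positivity)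
      H.nonneg ?_
    · exact ((hasMomentRate_affineSum hξ H).comp
        fun x : (Finset ℤ × Finset ι × ι) × ℤ => (x.1.2.1, x.2)).weight_mul fun x => g x.2 x.1.2.2
    · intro x
      simpa using hg x.2.2 x.1
  simp only [Finset.sum_add_distrib]
  exact (key H H'.col).add (key H' H.col) fun _ => zero_le_one

theorem abs_sum_mul_le {ι : Type*} {h h' : ℤ → ι → ℝ} {M M' : ℤ → ℝ} {B : ℝ}
    (H : IsStableFilter M h B) (H' : IsStableFilter M' h' B) (T : Finset ℤ) (a : ι) :
    |∑ l ∈ T, h l a * h' l a| ≤ B * B := by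
  refine (Finset.abs_sum_le_sum_abs _ _).trans ?_
  calc ∑ l ∈ T, |h l a * h' l a| ≤ ∑ l ∈ T, |h l a| * B := by
        refine Finset.sum_le_sum fun l _ => ?_
        rw [abs_mul]
        exact mul_le_mul_of_nonneg_left (by simpa using H'.row l {a}) (abs_nonneg _)
    _ ≤ B * B := by
        rw [← Finset.sum_mul]
        exact mul_le_mul_of_nonneg_right (H.col a T) H.nonneg

/-- The centred form is built up one noise variable at a time. Each increment has bounded moments
and is orthogonal to odd powers of the current sum, so the bound depends on the number of noise
variables and not on `T`. -/
theorem quadratic_moment_bound {ξ : ι → Ω → ℝ} (hξ : IsNoiseFamily μ ξ) {M M' : ℤ → ℝ}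
    {h h' : ℤ → ι → ℝ} {B : ℝ} (H : IsStableFilter M h B) (H' : IsStableFilter M' h' B)
    {m : ℕ} (hm : 1 ≤ m) :
    ∃ C : ℝ, ∀ (T : Finset ℤ) (J : Finset ι) (n : ℕ), 1 ≤ n → J.card ≤ n →
      ∫ ω, (∑ l ∈ T, affineSum ξ M h J l ω * affineSum ξ M' h' J l ω -
        ∫ ω', ∑ l ∈ T, affineSum ξ M h J l ω' * affineSum ξ M' h' J l ω' ∂μ) ^ (2 * m) ∂μ ≤
        C * (n : ℝ) ^ m := by
  classical
  set V : Finset ℤ → Finset ι → ι → Ω → ℝ := fun T J a ω =>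
    ∑ l ∈ T, (h' l a * affineSum ξ M h J l ω + h l a * affineSum ξ M' h' J l ω) with hV
  set W : Finset ℤ → Finset ι → Ω → ℝ := fun T J ω =>
    ∑ l ∈ T, affineSum ξ M h J l ω * affineSum ξ M' h' J l ω with hW
  set A : Finset ℤ → ι → ℝ := fun T a => ∑ l ∈ T, h l a * h' l a with hA
  set σ : ι → ℝ := fun a => ∫ ω, ξ a ω ^ 2 ∂μ with hσ
  have hVr : HasMomentRate μ (fun (x : Finset ℤ × Finset ι × ι) => V x.1 x.2.1 x.2.2)
      (fun _ => 1) := hasMomentRate_increment hξ H H'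
  have hsq : HasMomentRate μ (fun s ω => ξ s ω ^ 2) (fun _ => 1) := by
    simpa using hξ.moments.pow (fun _ => zero_le_one) 2
  obtain ⟨c₂, hc₂, hc₂'⟩ := hξ.moments.integral_pow_le (fun _ => zero_le_one) (p := 2) (by norm_num)
  have hσr : HasMomentRate μ (fun s (_ : Ω) => -σ s) (fun _ => 1) := by
    refine HasMomentRate.of_le_const hc₂ fun s => ?_
    rw [abs_neg, abs_of_nonneg (integral_nonneg fun ω => sq_nonneg _)]
    simpa using hc₂' s
  have hsq' : HasMomentRate μ (fun s ω => ξ s ω ^ 2 + -σ s) (fun _ => 1) :=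
    hsq.add hσr fun _ => zero_le_one
  -- The centred increment contributed by one noise variable, bounded uniformly in the time window
  -- and in the set already exposed.
  have hDr : HasMomentRate μ (fun (x : Finset ℤ × Finset ι × ι) ω =>
      V x.1 x.2.1 x.2.2 ω * ξ x.2.2 ω + A x.1 x.2.2 * (ξ x.2.2 ω ^ 2 + -σ x.2.2))
      (fun _ => 1) := by
    refine HasMomentRate.add ?_ ?_ fun _ => zero_le_one
    · simpa using hVr.mul (hξ.moments.comp fun x : Finset ℤ × Finset ι × ι => x.2.2)
        fun _ => zero_le_one
    · refine ((hsq'.comp fun x : Finset ℤ × Finset ι × ι => x.2.2).weight_mul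
        fun x => A x.1 x.2.2).of_weight_le (mul_nonneg H.nonneg H.nonneg) fun x => ?_
      simpa using abs_sum_mul_le H H' x.1 x.2.2
  obtain ⟨d, hd, hd'⟩ := hDr.integral_pow_le (fun _ => zero_le_one) (p := 2 * m) (by omega)
  have hWm : ∀ T J (p : ℕ), MemLp (W T J) p μ := by
    intro T J p
    refine memLp_finsetSum _ fun l _ => ?_
    exact memLp_mul_of_forall (fun p => (hasMomentRate_affineSum hξ H).memLp (J, l) p)
      (fun p => (hasMomentRate_affineSum hξ H').memLp (J, l) p) p
  refine ⟨2 * 2 ^ (2 * m) * d * Real.exp (2 ^ (2 * m)), fun T J n hn hJ => ?_⟩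
  have hn' : (1 : ℝ) ≤ n := by exact_mod_cast hn
  set S : Finset ι → Ω → ℝ := fun J ω => W T J ω - ∫ ω', W T J ω' ∂μ with hS
  have hSm : ∀ J (p : ℕ), MemLp (S J) p μ := fun J p => (hWm T J p).sub (memLp_const _)
  have main : ∀ J : Finset ι, ∫ ω, S J ω ^ (2 * m) ∂μ ≤
      (J.card : ℝ) * ((2 * 2 ^ (2 * m) * d) * (n : ℝ) ^ (m - 1)) *
        (1 + 2 ^ (2 * m) / (n : ℝ)) ^ J.card := by
    intro J
    induction J using Finset.induction_on with
    | empty =>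
      have : ∀ ω, S ∅ ω = 0 := by intro ω; simp [hS, hW, affineSum]
      simp [this, show m ≠ 0 by omega]
    | insert a J ha ih =>
      rw [Finset.card_insert_of_notMem ha]
      set D : Ω → ℝ := fun ω => V T J a ω * ξ a ω + A T a * (ξ a ω ^ 2 + -σ a) with hD
      have hDm : ∀ p : ℕ, MemLp D p μ := fun p => hDr.memLp (T, J, a) p
      have hle : (⨆ s ∈ (J : Set ι), MeasurableSpace.comap (ξ s) inferInstance) ≤ mΩ :=
        iSup₂_le fun s _ => (hξ.measurable s).comap_le
      have hξJ : ∀ s ∈ J, Measurable[⨆ s ∈ (J : Set ι), MeasurableSpace.comap (ξ s) inferInstance]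
          (ξ s) := fun s hs => (comap_measurable (ξ s)).mono
            (le_iSup₂_of_le s (Finset.mem_coe.2 hs) le_rfl) le_rfl
      have hWmeas := measurable_sum_affineSum_mul hξJ M M' h h' T
      have hVmeas := measurable_sum_affineSum hξJ M M' h h' T a
      have hSmeas := (hWmeas.sub_const (∫ ω', W T J ω' ∂μ)).pow_const (2 * m - 1)
      have hind := indep_comap_iSup hξ ha
      have hVξ0 : ∫ ω, V T J a ω * ξ a ω ∂μ = 0 :=
        integral_mul_eq_zero_of_indep hle (hξ.measurable a).comap_le hind hVmeas
          (comap_measurable (ξ a)) (hξ.mean a)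
      have hsq0 : ∫ ω, (ξ a ω ^ 2 + -σ a) ∂μ = 0 := by
        rw [integral_add (hsq.integrable a) (integrable_const _)]
        simp [hσ]
      have hVξi : Integrable (fun ω => V T J a ω * ξ a ω) μ :=
        integrable_of_forall_memLp (memLp_mul_of_forall (fun p => hVr.memLp (T, J, a) p)
          (fun p => hξ.moments.memLp a p))
      have hD0 : ∫ ω, D ω ∂μ = 0 := by
        rw [hD, integral_add hVξi ((hsq'.integrable a).const_mul _), hVξ0, integral_const_mul,
          hsq0]
        simp
      have hWeq : ∀ ω, W T (insert a J) ω = W T J ω + (D ω + A T a * σ a) := by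
        intro ω
        simp only [hW, hD, hV, hA, sum_affineSum_mul_insert ξ M M' h h' T ha]
        ring
      have hWint : ∫ ω, W T (insert a J) ω ∂μ = ∫ ω, W T J ω ∂μ + A T a * σ a := by
        have hDi : Integrable (fun ω => D ω + A T a * σ a) μ :=
          (integrable_of_forall_memLp hDm).add (integrable_const _)
        simp_rw [hWeq]
        rw [integral_add (integrable_of_forall_memLp (hWm T J)) hDi,
          integral_add (integrable_of_forall_memLp hDm) (integrable_const _), hD0]
        simp
      have hSeq : ∀ ω, S (insert a J) ω = S J ω + D ω := by
        intro ω
        simp only [hS]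
        rw [hWint, hWeq]
        ring
      -- Both `S J` and `V T J a` are functions of the noise in `J`, hence independent of `ξ a`, and
      -- both `ξ a` and `ξ a ^ 2 - σ a` are centred.
      have horth : ∫ ω, S J ω ^ (2 * m - 1) * D ω ∂μ = 0 := by
        have e : ∀ ω, S J ω ^ (2 * m - 1) * D ω = S J ω ^ (2 * m - 1) * V T J a ω * ξ a ω +
            A T a * (S J ω ^ (2 * m - 1) * (ξ a ω ^ 2 + -σ a)) := by
          intro ω; simp only [hD]; ring
        simp_rw [e]
        have hSp := memLp_pow_of_forall (hSm J) (2 * m - 1)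
        rw [integral_add, integral_const_mul]
        · have t1 : ∫ ω, S J ω ^ (2 * m - 1) * V T J a ω * ξ a ω ∂μ = 0 :=
            integral_mul_eq_zero_of_indep hle (hξ.measurable a).comap_le hind
              (hSmeas.mul hVmeas) (comap_measurable (ξ a)) (hξ.mean a)
          have t2 : ∫ ω, S J ω ^ (2 * m - 1) * (ξ a ω ^ 2 + -σ a) ∂μ = 0 :=
            integral_mul_eq_zero_of_indep hle (hξ.measurable a).comap_le hind
              hSmeas (((comap_measurable (ξ a)).pow_const 2).add_const (-σ a)) hsq0
          rw [t1, t2]; simp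
        · exact integrable_of_forall_memLp (memLp_mul_of_forall
            (memLp_mul_of_forall hSp (fun p => hVr.memLp (T, J, a) p))
            (fun p => hξ.moments.memLp a p))
        · exact (integrable_of_forall_memLp (memLp_mul_of_forall hSp
            (fun p => hsq'.memLp a p))).const_mul _
      have step := integral_add_pow_even_le (hSm J) hDm hm hn' horth
      have hDb : ∫ ω, D ω ^ (2 * m) ∂μ ≤ d := by
        have := hd' (T, J, a)
        simp only [(even_two_mul m).pow_abs, one_pow, mul_one] at this
        exact this
      simp_rw [hSeq]
      refine growth_step J.card (by positivity) (by positivity) ih (step.trans ?_)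
      have : 2 * 2 ^ (2 * m) * (n : ℝ) ^ (m - 1) * ∫ ω, D ω ^ (2 * m) ∂μ ≤
          2 * 2 ^ (2 * m) * (n : ℝ) ^ (m - 1) * d := by gcongr
      linarith
  exact growth_bound hm hn hJ (by positivity) (by positivity) (main J)

end LinearProcesses

/-! ### Processes produced by stable causal filters. -/

section LinearProcess

variable {Ω : Type*} [MeasurableSpace Ω] {μ : Measure Ω} {q : ℕ}

/-- `X` is, up to null sets, a bounded deterministic signal plus a uniformly stable causal filter
of the noise `ξ`, whose indices are pairs of a time and a channel. -/
def IsLinearProcess (μ : Measure Ω) (ξ : ℕ × Fin q → Ω → ℝ) (X : ℤ → Ω → ℝ) : Prop :=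
  ∃ (M : ℤ → ℝ) (h : ℤ → ℕ × Fin q → ℝ) (B : ℝ), IsStableFilter M h B ∧
    ∀ (l : ℤ) (K : ℕ), l < K →
      X l =ᵐ[μ] affineSum ξ M h (Finset.range K ×ˢ Finset.univ) l

namespace IsLinearProcess

variable {ξ : ℕ × Fin q → Ω → ℝ} {X Z : ℤ → Ω → ℝ}

theorem neg (hX : IsLinearProcess μ ξ X) : IsLinearProcess μ ξ (fun l ω => -X l ω) := by
  obtain ⟨M, h, B, H, hx⟩ := hX
  refine ⟨fun l => -M l, fun l s => -h l s, B, ⟨?_, ?_, ?_⟩, fun l K hl => ?_⟩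
  · simpa using H.mean_le
  · simpa using H.row
  · simpa using H.col
  · filter_upwards [hx l K hl] with ω hω
    rw [hω]
    simp only [affineSum, neg_mul, Finset.sum_neg_distrib]
    ring

theorem shift (hX : IsLinearProcess μ ξ X) {c : ℤ} (hc : 0 ≤ c) :
    IsLinearProcess μ ξ (fun l ω => X (l - c) ω) := by
  obtain ⟨M, h, B, H, hx⟩ := hX
  refine ⟨fun l => M (l - c), fun l s => h (l - c) s, B,
    ⟨fun l => H.mean_le _, fun l F => H.row _ F, fun s F => ?_⟩, fun l K hl => ?_⟩
  · refine le_trans (le_of_eq ?_) (H.col s (F.map (Equiv.subRight c).toEmbedding))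
    simp
  · exact hx (l - c) K (by linarith)

variable [IsProbabilityMeasure μ]

theorem hasMomentRate (hξ : IsNoiseFamily μ ξ) (hX : IsLinearProcess μ ξ X) :
    HasMomentRate μ X (fun _ => 1) := by
  obtain ⟨M, h, B, H, hx⟩ := hX
  refine ((hasMomentRate_affineSum hξ H).comp fun l : ℤ =>
    (Finset.range (l.toNat + 1) ×ˢ (Finset.univ : Finset (Fin q)), l)).congr fun l => ?_
  exact (hx l (l.toNat + 1) (by push_cast; linarith [Int.self_le_toNat l])).symm

/-- Sample covariances of linear processes concentrate around their means at the rate `√K`. -/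
theorem hasMomentRate_sum_mul (hξ : IsNoiseFamily μ ξ) (hX : IsLinearProcess μ ξ X)
    (hZ : IsLinearProcess μ ξ Z) :
    HasMomentRate μ (fun (K : ℕ) ω => ∑ l ∈ Finset.Icc 1 K, X (l : ℤ) ω * Z (l : ℤ) ω -
      ∑ l ∈ Finset.Icc 1 K, ∫ ω', X (l : ℤ) ω' * Z (l : ℤ) ω' ∂μ)
      (fun K => Real.sqrt (K + 1)) := by
  have hXr := hX.hasMomentRate hξ
  have hZr := hZ.hasMomentRate hξ
  obtain ⟨M, h, B, H, hx⟩ := hX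
  obtain ⟨M', h', B', H', hz⟩ := hZ
  have H₁ := H.mono (le_max_left B B')
  have H₂ := H'.mono (le_max_right B B')
  have hXZ : ∀ (l : ℤ) (p : ℕ), MemLp (fun ω => X l ω * Z l ω) p μ := fun l =>
    memLp_mul_of_forall (fun p => hXr.memLp l p) (fun p => hZr.memLp l p)
  refine HasMomentRate.of_integral_even_pow_le (fun K => Real.sqrt_nonneg _) (fun K p => ?_) ?_
  · exact (memLp_finsetSum (Finset.Icc 1 K) (f := fun (l : ℕ) ω => X (l : ℤ) ω * Z (l : ℤ) ω)
      fun l _ => hXZ l p).sub (memLp_const _)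
  intro m hm
  obtain ⟨C, hC⟩ := quadratic_moment_bound hξ H₁ H₂ hm
  refine ⟨C * ((q : ℝ) + 1) ^ m, fun K => ?_⟩
  set J : Finset (ℕ × Fin q) := Finset.range (K + 1) ×ˢ Finset.univ with hJ
  set T : Finset ℤ := (Finset.Icc 1 K).map Nat.castEmbedding with hT
  have hae : (fun ω => ∑ l ∈ Finset.Icc 1 K, X (l : ℤ) ω * Z (l : ℤ) ω) =ᵐ[μ]
      fun ω => ∑ l ∈ T, affineSum ξ M h J l ω * affineSum ξ M' h' J l ω := by
    have hall : ∀ l ∈ Finset.Icc 1 K, ∀ᵐ ω ∂μ, X (l : ℤ) ω * Z (l : ℤ) ω =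
        affineSum ξ M h J l ω * affineSum ξ M' h' J l ω := by
      intro l hl
      have hl' : ((l : ℕ) : ℤ) < ((K + 1 : ℕ) : ℤ) := by
        rw [Finset.mem_Icc] at hl; omega
      filter_upwards [hx l (K + 1) hl', hz l (K + 1) hl'] with ω h1 h2
      rw [h1, h2]
    filter_upwards [(Finset.eventually_all _).2 hall] with ω hω
    rw [hT, Finset.sum_map]
    exact Finset.sum_congr rfl hω
  have hint : ∑ l ∈ Finset.Icc 1 K, ∫ ω', X (l : ℤ) ω' * Z (l : ℤ) ω' ∂μ =
      ∫ ω', ∑ l ∈ T, affineSum ξ M h J l ω' * affineSum ξ M' h' J l ω' ∂μ := by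
    rw [← integral_congr_ae hae, integral_finsetSum]
    exact fun l _ => integrable_of_forall_memLp (hXZ l)
  rw [hint, integral_congr_ae (g := fun ω =>
    (∑ l ∈ T, affineSum ξ M h J l ω * affineSum ξ M' h' J l ω -
        ∫ ω', ∑ l ∈ T, affineSum ξ M h J l ω' * affineSum ξ M' h' J l ω' ∂μ) ^ (2 * m))
    (hae.mono fun ω hω => by simp only at hω ⊢; rw [hω])]
  -- Up to time `K` there are `(K + 1) * q` noise variables; `q + 1` keeps the count positive when
  -- there is no channel.
  refine (hC T J ((K + 1) * (q + 1)) (by nlinarith) ?_).trans_eq ?_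
  · rw [hJ, Finset.card_product, Finset.card_range, Finset.card_univ, Fintype.card_fin]
    nlinarith
  · rw [pow_mul, Real.sq_sqrt (by positivity)]
    push_cast
    rw [mul_pow]
    ring

end IsLinearProcess

theorem sum_comp_le_tsum {α β : Type*} {G : β → ℝ} (hG : Summable G) (hG0 : ∀ z, 0 ≤ G z)
    {σ : α → β} (hσ : Function.Injective σ) (F : Finset α) :
    ∑ a ∈ F, G (σ a) ≤ ∑' z, G z := by
  have := hG.sum_le_tsum (F.map ⟨σ, hσ⟩) fun z _ => hG0 z
  simpa using this

/-- A summable bound in the lag alone controls both rows and columns; a row meets each lag once per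
channel, hence the factor depending on `q`. -/
theorem isStableFilter_of_le {M : ℤ → ℝ} {h : ℤ → ℕ × Fin q → ℝ} {G : ℤ → ℝ} {C : ℝ}
    (hM : ∀ l, |M l| ≤ C) (hG : Summable G) (hG0 : ∀ z, 0 ≤ G z)
    (hh : ∀ l s, |h l s| ≤ G (l - s.1)) :
    ∃ B, IsStableFilter M h B := by
  have hS : 0 ≤ ∑' z, G z := tsum_nonneg hG0
  have hC : 0 ≤ C := (abs_nonneg _).trans (hM 0)
  refine ⟨C + (q + 1) * ∑' z, G z, fun l => (hM l).trans (by nlinarith [Nat.cast_nonneg (α := ℝ) q]),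
    fun l F => ?_, fun s F => ?_⟩
  · classical
    calc ∑ s ∈ F, |h l s| ≤ ∑ s ∈ F, G (l - s.1) := Finset.sum_le_sum fun s _ => hh l s
      _ ≤ ∑ s ∈ (F.image Prod.fst) ×ˢ (Finset.univ : Finset (Fin q)), G (l - s.1) := by
          refine Finset.sum_le_sum_of_subset_of_nonneg (fun s hs => ?_) fun _ _ _ => hG0 _
          simpa using ⟨s.2, hs⟩
      _ = q * ∑ t ∈ F.image Prod.fst, G (l - t) := by
          rw [Finset.sum_product]
          simp [Finset.mul_sum]
      _ ≤ q * ∑' z, G z := by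
          refine mul_le_mul_of_nonneg_left ?_ (by positivity)
          refine sum_comp_le_tsum (σ := fun t : ℕ => l - (t : ℤ)) hG hG0 (fun a b hab => ?_) _
          simpa using hab
      _ ≤ _ := by linarith
  · calc ∑ l ∈ F, |h l s| ≤ ∑ l ∈ F, G (l - s.1) := Finset.sum_le_sum fun l _ => hh l s
      _ ≤ ∑' z, G z :=
          sum_comp_le_tsum (σ := fun l : ℤ => l - (s.1 : ℤ)) hG hG0 (fun a b hab => by
            simpa using hab) _
      _ ≤ _ := by nlinarith [Nat.cast_nonneg (α := ℝ) q]

theorem summable_zero_extension {g : ℕ → ℝ} (hg : Summable g) :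
    Summable fun z : ℤ => if 0 ≤ z then g z.toNat else 0 := by
  have hinj : Function.Injective (Nat.cast : ℕ → ℤ) := Nat.cast_injective
  rw [← hinj.summable_iff]
  · simpa [Function.comp_def] using hg
  · intro z hz
    refine if_neg fun h0 => hz ⟨z.toNat, Int.toNat_of_nonneg h0⟩

variable [IsProbabilityMeasure μ]

theorem IsDrivingNoise.isNoiseFamily {e : ℕ → Fin q → Ω → ℝ} {δ : ℝ} (he : IsDrivingNoise μ e δ) :
    IsNoiseFamily μ (fun s : ℕ × Fin q => e s.1 s.2) := by
  refine ⟨fun s => he.measurable _ _, he.indep, fun s => he.mean _ _, ?_⟩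
  refine HasMomentRate.of_integral_even_pow_le (fun _ => zero_le_one) (fun s p => ?_) fun m hm => ?_
  · rcases Nat.eq_zero_or_pos p with rfl | hp
    · simpa using (he.measurable s.1 s.2).aestronglyMeasurable
    obtain ⟨C, hC⟩ := he.moments p hp
    rw [← integrable_norm_rpow_iff (he.measurable s.1 s.2).aestronglyMeasurable
      (by simpa using hp.ne') (ENNReal.natCast_ne_top _)]
    simpa using (hC s.1 s.2).1
  · obtain ⟨C, hC⟩ := he.moments (2 * m) (by omega)
    refine ⟨C, fun s => ?_⟩
    have := (hC s.1 s.2).2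
    simpa [(even_two_mul m).pow_abs] using this

/-- A process generated by uniformly stable filters whose mean and mean square are bounded is a
linear process; the coefficients of lag `0` are bounded by the mean square. -/
theorem isLinearProcess_of_filter {e : ℕ → Fin q → Ω → ℝ} {δ : ℝ} (he : IsDrivingNoise μ e δ)
    {X : ℤ → Ω → ℝ} {M : ℕ → ℝ} {H : ℕ → Fin q → ℕ → ℝ} {g : ℕ → ℝ}
    (hneg : ∀ k : ℤ, k < 0 → ∀ ω, X k ω = 0)
    (hX : ∀ k : ℕ, ∀ ω, X (k : ℤ) ω =
      M k + ∑ i ∈ Finset.Icc 0 k, ∑ c, H k c i * e (k - i) c ω)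
    (hH : ∀ k i : ℕ, 1 ≤ k → 1 ≤ i → ∀ c, |H k c i| ≤ |g i|)
    (hg : Summable fun i => |g i|)
    {C : ℝ} (hmean : ∀ k : ℕ, 1 ≤ k → |∫ ω, X (k : ℤ) ω ∂μ| ≤ C)
    (hsq : ∀ k : ℕ, 1 ≤ k → ∫ ω, X (k : ℤ) ω * X (k : ℤ) ω ∂μ ≤ C) :
    IsLinearProcess μ (fun s : ℕ × Fin q => e s.1 s.2) X := by
  have hξ := he.isNoiseFamily
  set ξ : ℕ × Fin q → Ω → ℝ := fun s => e s.1 s.2 with hξdef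
  set M' : ℤ → ℝ := fun l => if 0 ≤ l then M l.toNat else 0 with hM'
  set h : ℤ → ℕ × Fin q → ℝ := fun l s =>
    if (s.1 : ℤ) ≤ l then H l.toNat s.2 (l.toNat - s.1) else 0 with hh
  have hrep : ∀ (l : ℤ) (K : ℕ), l < K → ∀ ω,
      X l ω = affineSum ξ M' h (Finset.range K ×ˢ Finset.univ) l ω := by
    intro l K hl ω
    rcases lt_or_ge l 0 with h0 | h0
    · rw [hneg l h0, affineSum, Finset.sum_eq_zero]
      · simp [hM', not_le.2 h0]
      · intro s _
        have : ¬ (s.1 : ℤ) ≤ l := by omega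
        simp [hh, this]
    · lift l to ℕ using h0
      have hl' : l + 1 ≤ K := by exact_mod_cast hl
      rw [hX, affineSum]
      refine congrArg₂ (· + ·) (by simp [hM']) ?_
      · rw [Finset.sum_product,
          ← Finset.sum_subset (Finset.range_mono hl') (fun t _ ht => ?_),
          ← Finset.sum_range_reflect, Nat.range_succ_eq_Icc_zero]
        · refine Finset.sum_congr rfl fun i hi => Finset.sum_congr rfl fun c _ => ?_
          have hi' : i ≤ l := (Finset.mem_Icc.1 hi).2
          have e1 : l + 1 - 1 - i = l - i := by omega
          have e2 : ((l - i : ℕ) : ℤ) ≤ (l : ℤ) := by omega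
          have e3 : l - (l - i) = i := by omega
          simp only [hh, hξdef, e1, e2, if_true, Int.toNat_natCast, e3]
        · refine Finset.sum_eq_zero fun c _ => ?_
          have : ¬ ((t : ℕ) : ℤ) ≤ (l : ℤ) := by
            simp only [Finset.mem_range] at ht; omega
          simp only [hh, this, if_false, zero_mul]
  have hterm : ∀ l s (p : ℕ), MemLp (fun ω => h l s * ξ s ω) p μ := fun l s p =>
    (hξ.moments.memLp s p).const_mul _
  have hXm : ∀ (l : ℤ) (p : ℕ), MemLp (X l) p μ := by
    intro l p
    rw [funext (hrep l (l.toNat + 1) (by push_cast; linarith [Int.self_le_toNat l]))]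
    have h1 := memLp_finsetSum (Finset.range (l.toNat + 1) ×ˢ (Finset.univ : Finset (Fin q)))
      fun s _ => hterm l s p
    exact (memLp_const (M' l)).add h1
  have hXmean : ∀ l : ℤ, ∫ ω, X l ω ∂μ = M' l := by
    intro l
    rw [funext (hrep l (l.toNat + 1) (by push_cast; linarith [Int.self_le_toNat l]))]
    simp only [affineSum]
    rw [integral_add (integrable_const _) (integrable_finsetSum _ fun s _ =>
      integrable_of_forall_memLp (hterm l s)), integral_finsetSum _ fun s _ =>
      integrable_of_forall_memLp (hterm l s)]
    simp [integral_const_mul, hξ.mean]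
  have hMb : ∀ l, |M' l| ≤ max C |M 0| := by
    intro l
    rcases lt_trichotomy l 0 with h0 | rfl | h0
    · simp [hM', not_le.2 h0]
    · simp [hM']
    · rw [← hXmean]
      lift l to ℕ using h0.le
      exact (hmean l (by omega)).trans (le_max_left _ _)
  -- Without noise variance the lag-zero coefficients cannot be controlled, but the noise then
  -- vanishes almost surely and the zero filter serves.
  by_cases hδ : δ = 0
  · have hzero : ∀ s, ξ s =ᵐ[μ] fun _ => 0 := by
      intro s
      have := ae_eq_integral_of_variance_eq_zero (hξ.moments.memLp_two s)
        (by rw [hξdef, he.variance, hδ]; norm_num)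
      rwa [hξ.mean s] at this
    refine ⟨M', fun _ _ => 0, max C |M 0|, ⟨hMb, fun l F => ?_, fun s F => ?_⟩, fun l K hl => ?_⟩
    · simp
    · simp
    · have hall := (Finset.eventually_all (Finset.range K ×ˢ (Finset.univ : Finset (Fin q)))).2
        fun s _ => hzero s
      filter_upwards [hall] with ω hω
      rw [hrep l K hl ω, affineSum, affineSum,
        Finset.sum_eq_zero (fun s hs => by rw [hω s hs, mul_zero]),
        Finset.sum_eq_zero fun s _ => by rw [zero_mul]]
  -- By independence the variance of `X l` is a sum of nonnegative contributions, one of which is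
  -- the lag-zero term of channel `c`.
  have hvar : ∀ (l : ℕ) c, 1 ≤ l → H l c 0 ^ 2 * δ ^ 2 ≤ C := by
    intro l c hl
    have h1 : Var[X l; μ] ≤ C := by
      refine (variance_le_expectation_sq (hXm l 1).1).trans ?_
      refine le_trans (le_of_eq ?_) (hsq l hl)
      exact integral_congr_ae (ae_of_all _ fun ω => by simp [sq])
    refine le_trans ?_ h1
    rw [funext (hrep l (l + 1) (by push_cast; omega))]
    change _ ≤ Var[fun ω => M' l + ∑ s ∈ Finset.range (l + 1) ×ˢ (Finset.univ : Finset (Fin q)),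
      h l s * ξ s ω; μ]
    rw [variance_const_add (memLp_finsetSum _ fun s _ => hterm l s 1).1]
    have e0 : (fun ω => ∑ s ∈ Finset.range (l + 1) ×ˢ (Finset.univ : Finset (Fin q)),
        h l s * ξ s ω) = ∑ s ∈ Finset.range (l + 1) ×ˢ (Finset.univ : Finset (Fin q)),
        fun ω => h l s * ξ s ω := by ext; simp
    rw [e0, IndepFun.variance_sum (fun s _ => by simpa using hterm l s 2)]
    · have hpos : ∀ s ∈ Finset.range (l + 1) ×ˢ (Finset.univ : Finset (Fin q)),
          0 ≤ Var[fun ω => h l s * ξ s ω; μ] := fun s _ => variance_nonneg _ _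
      refine le_trans (le_of_eq ?_) (Finset.single_le_sum hpos (a := (l, c)) (by simp))
      rw [variance_const_mul, show Var[ξ (l, c); μ] = δ ^ 2 from he.variance _ _]
      simp [hh]
    · intro s _ s' _ hss
      exact (hξ.indep.indepFun hss).comp (measurable_const_mul _) (measurable_const_mul _)
  -- The square root bounds the lag-zero coefficients at times `l ≥ 1`; the finite sum covers time
  -- `0`, where no moment bound is assumed.
  set C₀ : ℝ := Real.sqrt (C / δ ^ 2) + ∑ c, |H 0 c 0| with hC₀
  have hC₀0 : 0 ≤ C₀ := by positivity
  set G : ℤ → ℝ := fun z => if 0 ≤ z then (if z.toNat = 0 then C₀ else 0) + |g z.toNat| else 0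
    with hG
  have hGs : Summable G := by
    refine summable_zero_extension (g := fun i => (if i = 0 then C₀ else 0) + |g i|) ?_
    exact (summable_of_ne_finset_zero (s := {0}) (fun b hb => by
      simp only [Finset.mem_singleton] at hb; simp [hb])).add hg
  have hG0 : ∀ z, 0 ≤ G z := by
    intro z
    simp only [hG]
    split_ifs <;> positivity
  obtain ⟨B, hB⟩ := isStableFilter_of_le (h := h) hMb hGs hG0 (by
    intro l s
    by_cases hs : (s.1 : ℤ) ≤ l
    · have hl0 : 0 ≤ l := by omega
      lift l to ℕ using hl0
      have hs' : s.1 ≤ l := by exact_mod_cast hs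
      have e1 : (0 : ℤ) ≤ (l : ℤ) - s.1 := by omega
      have e2 : ((l : ℤ) - s.1).toNat = l - s.1 := by omega
      simp only [hh, hG, hs, e1, e2, if_true, Int.toNat_natCast]
      rcases Nat.eq_zero_or_pos (l - s.1) with h0 | h0
      · rw [h0, if_pos rfl]
        refine le_trans ?_ (le_add_of_nonneg_right (abs_nonneg _))
        rcases Nat.eq_zero_or_pos l with rfl | hl
        · refine le_add_of_nonneg_of_le (Real.sqrt_nonneg _) ?_
          exact Finset.single_le_sum (f := fun c => |H 0 c 0|) (fun c _ => abs_nonneg _)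
            (Finset.mem_univ s.2)
        · refine le_add_of_le_of_nonneg ?_ (by positivity)
          refine Real.abs_le_sqrt ?_
          rw [le_div_iff₀ (by positivity)]
          exact hvar l s.2 hl
      · rw [if_neg h0.ne', zero_add]
        exact hH l _ (by omega) h0 _
    · simp only [hh, hs, if_false, abs_zero]
      exact hG0 _)
  exact ⟨M', h, B, hB, fun l K hl => ae_of_all _ (hrep l K hl)⟩

end LinearProcess

/-! ### Deterministic algebra of recursive least squares and a lower bound on the information
matrix. -/

section LeastSquares

variable {N : ℕ}

/-- The unnormalized sample covariance of `φ 1, …, φ k`. -/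
def gram (φ : ℕ → Fin N → ℝ) (k : ℕ) : Matrix (Fin N) (Fin N) ℝ :=
  Matrix.of fun i j => ∑ l ∈ Finset.Icc 1 k, φ l i * φ l j

theorem gram_zero (φ : ℕ → Fin N → ℝ) : gram φ 0 = 0 := by
  ext; simp [gram]

theorem gram_succ (φ : ℕ → Fin N → ℝ) (k : ℕ) :
    gram φ (k + 1) = gram φ k + Matrix.vecMulVec (φ (k + 1)) (φ (k + 1)) := by
  ext i j
  simp [gram, Finset.sum_Icc_succ_top, Matrix.vecMulVec_apply]

theorem vecMulVec_mulVec_eq_smul (v w x : Fin N → ℝ) :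
    Matrix.vecMulVec v w *ᵥ x = (w ⬝ᵥ x) • v := by
  rw [Matrix.vecMulVec_mulVec]
  ext i
  simp [mul_comm]

theorem gram_quadratic_nonneg (φ : ℕ → Fin N → ℝ) (k : ℕ) (x : Fin N → ℝ) :
    0 ≤ x ⬝ᵥ gram φ k *ᵥ x := by
  induction k with
  | zero => simp [gram_zero]
  | succ k ih =>
    rw [gram_succ, Matrix.add_mulVec, dotProduct_add, vecMulVec_mulVec_eq_smul, dotProduct_smul,
      dotProduct_comm x (φ (k + 1)), smul_eq_mul]
    exact add_nonneg ih (mul_self_nonneg _)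

theorem covMat_succ_mulVec (φ : ℕ → Fin N → ℝ) (P₀ : Matrix (Fin N) (Fin N) ℝ) (k : ℕ)
    (x : Fin N → ℝ) :
    covMat φ P₀ (k + 1) *ᵥ x = covMat φ P₀ k *ᵥ x -
      (gain (covMat φ P₀ k) (φ (k + 1)) * (φ (k + 1) ⬝ᵥ covMat φ P₀ k *ᵥ x)) •
        (covMat φ P₀ k *ᵥ φ (k + 1)) := by
  rw [covMat, Matrix.sub_mulVec, Matrix.smul_mulVec, ← Matrix.mulVec_mulVec,
    ← Matrix.mulVec_mulVec, vecMulVec_mulVec_eq_smul, Matrix.mulVec_smul, smul_smul]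

variable {φ : ℕ → Fin N → ℝ} {P₀ Λ₀ : Matrix (Fin N) (Fin N) ℝ}

/-- With `z = P *ᵥ v`, the hypothesis turns `v ⬝ᵥ P *ᵥ v` into the quadratic form of `Λ₀ + gram φ k`
at `z`, so neither symmetry nor positivity of `P` has to be carried along the recursion. -/
theorem one_add_quadratic_pos {k : ℕ} (hΛ : ∀ x, 0 ≤ x ⬝ᵥ Λ₀ *ᵥ x) {P : Matrix (Fin N) (Fin N) ℝ}
    {v : Fin N → ℝ} (hP : (Λ₀ + gram φ k) *ᵥ (P *ᵥ v) = v) : 1 ≤ 1 + v ⬝ᵥ P *ᵥ v := by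
  have h : v ⬝ᵥ P *ᵥ v = (P *ᵥ v) ⬝ᵥ (Λ₀ + gram φ k) *ᵥ (P *ᵥ v) := by rw [hP, dotProduct_comm]
  rw [h, Matrix.add_mulVec, dotProduct_add]
  linarith [hΛ (P *ᵥ v), gram_quadratic_nonneg φ k (P *ᵥ v)]

/-- The recursion for `covMat` computes the inverse of the information matrix. -/
theorem information_mulVec_covMat (hΛ : ∀ x, 0 ≤ x ⬝ᵥ Λ₀ *ᵥ x) (h₀ : Λ₀ * P₀ = 1) (k : ℕ)
    (x : Fin N → ℝ) : (Λ₀ + gram φ k) *ᵥ (covMat φ P₀ k *ᵥ x) = x := by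
  induction k generalizing x with
  | zero => rw [gram_zero, add_zero, covMat, Matrix.mulVec_mulVec, h₀, Matrix.one_mulVec]
  | succ k ih =>
    have hpos := one_add_quadratic_pos hΛ (ih (φ (k + 1)))
    have hg : gain (covMat φ P₀ k) (φ (k + 1)) *
        (1 + φ (k + 1) ⬝ᵥ covMat φ P₀ k *ᵥ φ (k + 1)) = 1 := inv_mul_cancel₀ (by linarith)
    rw [gram_succ, ← add_assoc, Matrix.add_mulVec, covMat_succ_mulVec, Matrix.mulVec_sub,
      Matrix.mulVec_smul, ih, ih, vecMulVec_mulVec_eq_smul, dotProduct_sub, dotProduct_smul]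
    ext i
    simp only [Pi.add_apply, Pi.sub_apply, Pi.smul_apply, smul_eq_mul]
    linear_combination (-(φ (k + 1) ⬝ᵥ covMat φ P₀ k *ᵥ x) * φ (k + 1) i) * hg

theorem gain_nonneg_le_one (hΛ : ∀ x, 0 ≤ x ⬝ᵥ Λ₀ *ᵥ x) (h₀ : Λ₀ * P₀ = 1) (k : ℕ)
    (v : Fin N → ℝ) : 0 ≤ gain (covMat φ P₀ k) v ∧ gain (covMat φ P₀ k) v ≤ 1 := by
  have hpos := one_add_quadratic_pos hΛ (information_mulVec_covMat (φ := φ) hΛ h₀ k v)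
  exact ⟨inv_nonneg.2 (by linarith), inv_le_one_of_one_le₀ hpos⟩

/-- The error equation of recursive least squares. -/
theorem information_mulVec_rlsEst_sub (hΛ : ∀ x, 0 ≤ x ⬝ᵥ Λ₀ *ᵥ x) (h₀ : Λ₀ * P₀ = 1)
    {y : ℤ → ℝ} {d : ℕ → ℝ} {θ θ₀ : Fin N → ℝ}
    (hy : ∀ k : ℕ, 1 ≤ k → y k = φ k ⬝ᵥ θ + d k) (k : ℕ) :
    (Λ₀ + gram φ k) *ᵥ (rlsEst φ y P₀ θ₀ k - θ) =
      Λ₀ *ᵥ (θ₀ - θ) + ∑ l ∈ Finset.Icc 1 k, d l • φ l := by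
  induction k with
  | zero => simp [gram_zero, rlsEst]
  | succ k ih =>
    have hpos := one_add_quadratic_pos hΛ (information_mulVec_covMat (φ := φ) hΛ h₀ k (φ (k + 1)))
    have hg : gain (covMat φ P₀ k) (φ (k + 1)) *
        (1 + φ (k + 1) ⬝ᵥ covMat φ P₀ k *ᵥ φ (k + 1)) = 1 := inv_mul_cancel₀ (by linarith)
    rw [Finset.sum_Icc_succ_top (by omega), ← add_assoc, ← ih, rlsEst, hy (k + 1) (by omega),
      add_sub_right_comm, gram_succ, ← add_assoc, Matrix.add_mulVec, Matrix.mulVec_add,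
      Matrix.mulVec_smul, information_mulVec_covMat hΛ h₀, vecMulVec_mulVec_eq_smul,
      dotProduct_add, dotProduct_smul, dotProduct_sub]
    ext i
    simp only [Pi.add_apply, Pi.smul_apply, smul_eq_mul]
    linear_combination (φ (k + 1) ⬝ᵥ θ + d (k + 1) - φ (k + 1) ⬝ᵥ rlsEst φ y P₀ θ₀ k) *
      φ (k + 1) i * hg

theorem abs_dotProduct_le (v w : Fin N → ℝ) : |v ⬝ᵥ w| ≤ N * (‖v‖ * ‖w‖) := by
  rw [dotProduct]
  refine (Finset.abs_sum_le_sum_abs _ _).trans ?_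
  calc ∑ i, |v i * w i| ≤ ∑ _i : Fin N, ‖v‖ * ‖w‖ := by
        refine Finset.sum_le_sum fun i _ => ?_
        rw [abs_mul]
        exact mul_le_mul (norm_le_pi_norm v i) (norm_le_pi_norm w i) (abs_nonneg _) (norm_nonneg _)
    _ = _ := by simp

theorem abs_quadratic_le (A : Matrix (Fin N) (Fin N) ℝ) (x : Fin N → ℝ) :
    |x ⬝ᵥ A *ᵥ x| ≤ (∑ i, ∑ j, |A i j|) * ‖x‖ ^ 2 := by
  simp only [dotProduct, Matrix.mulVec, Finset.mul_sum, Finset.sum_mul]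
  refine (Finset.abs_sum_le_sum_abs _ _).trans (Finset.sum_le_sum fun i _ => ?_)
  refine (Finset.abs_sum_le_sum_abs _ _).trans (Finset.sum_le_sum fun j _ => ?_)
  rw [abs_mul, abs_mul]
  have h1 : |x i| ≤ ‖x‖ := norm_le_pi_norm x i
  have h2 : |x j| ≤ ‖x‖ := norm_le_pi_norm x j
  calc |x i| * (|A i j| * |x j|) = |A i j| * (|x i| * |x j|) := by ring
    _ ≤ |A i j| * (‖x‖ * ‖x‖) := by gcongr
    _ = _ := by ring

/-- Coercivity bounds the inverse. The norm on `Fin N → ℝ` is the supremum norm, whence the factor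
`N`. -/
theorem norm_le_of_coercive {A : Matrix (Fin N) (Fin N) ℝ} {x : Fin N → ℝ} {c : ℝ} (hc : 0 < c)
    (h : c * ‖x‖ ^ 2 ≤ x ⬝ᵥ A *ᵥ x) : ‖x‖ ≤ N / c * ‖A *ᵥ x‖ := by
  rcases (norm_nonneg x).eq_or_lt with h0 | h0
  · rw [← h0]; positivity
  · have h1 := h.trans ((le_abs_self _).trans (abs_dotProduct_le x (A *ᵥ x)))
    rw [div_mul_eq_mul_div, le_div_iff₀ hc]
    have h2 : ‖x‖ * (‖x‖ * c) ≤ ‖x‖ * (N * ‖A *ᵥ x‖) := by nlinarith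
    exact le_of_mul_le_mul_left h2 h0

/-- The constant is the minimum of the quadratic form on the compact unit sphere, extended by
homogeneity. -/
theorem _root_.Matrix.PosDef.exists_coercive [NeZero N] {A : Matrix (Fin N) (Fin N) ℝ}
    (hA : A.PosDef) : ∃ c : ℝ, 0 < c ∧ ∀ x : Fin N → ℝ, c * ‖x‖ ^ 2 ≤ x ⬝ᵥ A *ᵥ x := by
  have hcont : Continuous fun x : Fin N → ℝ => x ⬝ᵥ A *ᵥ x := by fun_prop
  obtain ⟨x₀, hx₀, hmin⟩ := (isCompact_sphere (0 : Fin N → ℝ) 1).exists_isMinOn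
    ((NormedSpace.sphere_nonempty (x := (0 : Fin N → ℝ)) (r := 1)).2 zero_le_one) hcont.continuousOn
  have hx₀' : x₀ ≠ 0 := by
    rintro rfl
    simp at hx₀
  refine ⟨x₀ ⬝ᵥ A *ᵥ x₀, by simpa using hA.dotProduct_mulVec_pos hx₀', fun x => ?_⟩
  rcases eq_or_ne x 0 with rfl | hx
  · simp
  have hn : 0 < ‖x‖ := norm_pos_iff.2 hx
  have hmem : ‖x‖⁻¹ • x ∈ Metric.sphere (0 : Fin N → ℝ) 1 := by
    simp [norm_smul, hn.ne']
  have := hmin hmem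
  simp only [Set.mem_ofPred_eq, Matrix.mulVec_smul, dotProduct_smul, smul_dotProduct,
    smul_eq_mul] at this
  calc x₀ ⬝ᵥ A *ᵥ x₀ * ‖x‖ ^ 2 ≤ ‖x‖⁻¹ * (‖x‖⁻¹ * x ⬝ᵥ A *ᵥ x) * ‖x‖ ^ 2 := by gcongr
    _ = x ⬝ᵥ A *ᵥ x := by field_simp

/-- If sample covariances concentrate around means whose averages converge to a positive definite
matrix, then the information matrix grows linearly, up to an error that is quadratic in the
fluctuation. -/
theorem exists_information_lower_bound [NeZero N] {R : Matrix (Fin N) (Fin N) ℝ} (hR : R.PosDef)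
    (hΛ₀ : Λ₀.PosDef) {E : ℕ → Matrix (Fin N) (Fin N) ℝ}
    (hE : ∀ i j, Tendsto (fun K : ℕ => 1 / (K : ℝ) * E K i j) atTop (𝓝 (R i j))) :
    ∃ C : ℝ, 0 ≤ C ∧ ∀ (φ : ℕ → Fin N → ℝ) (K : ℕ) (x : Fin N → ℝ),
      ‖x‖ ≤ C * (1 / ((K : ℝ) + 1) +
        ((∑ i, ∑ j, |gram φ K i j - E K i j|) / ((K : ℝ) + 1)) ^ 2) *
          ‖(Λ₀ + gram φ K) *ᵥ x‖ := by
  obtain ⟨r, hr, hr'⟩ := hR.exists_coercive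
  obtain ⟨c, hc, hc'⟩ := hΛ₀.exists_coercive
  have hlim : Tendsto (fun K : ℕ => ∑ i, ∑ j, |1 / (K : ℝ) * E K i j - R i j|) atTop (𝓝 0) := by
    have : Tendsto (fun K : ℕ => ∑ i, ∑ j, |1 / (K : ℝ) * E K i j - R i j|) atTop
        (𝓝 (∑ i : Fin N, ∑ j : Fin N, |R i j - R i j|)) :=
      tendsto_finsetSum _ fun i _ => tendsto_finsetSum _ fun j _ =>
        ((hE i j).sub tendsto_const_nhds).abs
    simpa using this
  obtain ⟨K₀, hK₀⟩ := eventually_atTop.1 (hlim.eventually (gt_mem_nhds (half_pos hr)))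
  set C₁ : ℝ := 8 * N / r with hC₁
  set C₂ : ℝ := N / c * (8 / r) ^ 2 with hC₂
  set C₃ : ℝ := N / c * (K₀ + 2) with hC₃
  have h1 : 0 ≤ C₁ := by positivity
  have h2 : 0 ≤ C₂ := by positivity
  have h3 : 0 ≤ C₃ := by positivity
  refine ⟨C₁ + C₂ + C₃, by positivity, fun φ K x => ?_⟩
  set D : ℝ := ∑ i, ∑ j, |gram φ K i j - E K i j| with hD
  have hD0 : 0 ≤ D := Finset.sum_nonneg fun i _ => Finset.sum_nonneg fun j _ => abs_nonneg _
  set v := (Λ₀ + gram φ K) *ᵥ x with hv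
  have hquad : x ⬝ᵥ v = x ⬝ᵥ Λ₀ *ᵥ x + x ⬝ᵥ gram φ K *ᵥ x := by
    rw [hv, Matrix.add_mulVec, dotProduct_add]
  have hgram := gram_quadratic_nonneg φ K x
  have hcrude : ‖x‖ ≤ N / c * ‖v‖ := norm_le_of_coercive hc (by rw [← hv, hquad]; linarith [hc' x])
  have hK1 : (0 : ℝ) < (K : ℝ) + 1 := by positivity
  have key : ∀ t : ℝ, t ≤ (C₁ + C₂ + C₃) * (1 / ((K : ℝ) + 1) + (D / ((K : ℝ) + 1)) ^ 2) →
      ‖x‖ ≤ t * ‖v‖ → ‖x‖ ≤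
        (C₁ + C₂ + C₃) * (1 / ((K : ℝ) + 1) + (D / ((K : ℝ) + 1)) ^ 2) * ‖v‖ :=
    fun t ht hx => hx.trans (mul_le_mul_of_nonneg_right ht (norm_nonneg _))
  have hs : 0 ≤ (D / ((K : ℝ) + 1)) ^ 2 := sq_nonneg _
  have hi : 0 ≤ 1 / ((K : ℝ) + 1) := by positivity
  -- Before the averaged means are close to `R`, only finitely many `K` occur, and the bound from
  -- `Λ₀` is absorbed into `C₃`.
  rcases lt_or_ge K (K₀ + 1) with hK | hK
  · refine key _ ?_ hcrude
    have h4 : N / c ≤ C₃ * (1 / ((K : ℝ) + 1)) := by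
      have : (K : ℝ) + 1 ≤ K₀ + 2 := by
        have : (K : ℝ) + 1 ≤ (K₀ : ℝ) + 1 := by exact_mod_cast hK
        linarith
      rw [hC₃, mul_one_div, le_div_iff₀ hK1]
      gcongr
    nlinarith
  -- For a small fluctuation the means contribute at least `K * r / 2` and the fluctuation removes
  -- at most `(K + 1) * r / 8`, which leaves `(K + 1) * r / 8` because `K ≥ 1`.
  rcases le_or_gt (D / ((K : ℝ) + 1)) (r / 8) with hDs | hDl
  · have hKge : (1 : ℝ) ≤ K := by exact_mod_cast (by omega : 1 ≤ K)
    have hb := (hK₀ K (by omega)).le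
    set b : ℝ := ∑ i, ∑ j, |1 / (K : ℝ) * E K i j - R i j| with hbdef
    have e1 := abs_quadratic_le (gram φ K - E K) x
    have e2 := abs_quadratic_le ((1 / (K : ℝ)) • E K - R) x
    have e3 : x ⬝ᵥ gram φ K *ᵥ x = x ⬝ᵥ (gram φ K - E K) *ᵥ x +
        K * (x ⬝ᵥ ((1 / (K : ℝ)) • E K - R) *ᵥ x) + K * (x ⬝ᵥ R *ᵥ x) := by
      simp only [Matrix.sub_mulVec, Matrix.smul_mulVec, dotProduct_sub, dotProduct_smul,
        smul_eq_mul]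
      field_simp
      ring
    simp only [Matrix.sub_apply, Matrix.smul_apply, smul_eq_mul] at e1 e2
    rw [← hD] at e1
    rw [← hbdef] at e2
    rw [div_le_iff₀ hK1] at hDs
    have e4 : r / 8 * ((K : ℝ) + 1) * ‖x‖ ^ 2 ≤ x ⬝ᵥ v := by
      have f1 := (abs_le.1 e1).1
      have f2 := (abs_le.1 e2).1
      have f3 := hr' x
      have f4 := hc' x
      have hx2 := sq_nonneg ‖x‖
      have f5 : b * ‖x‖ ^ 2 ≤ r / 2 * ‖x‖ ^ 2 := mul_le_mul_of_nonneg_right hb hx2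
      have f6 : D * ‖x‖ ^ 2 ≤ r / 8 * ((K : ℝ) + 1) * ‖x‖ ^ 2 :=
        mul_le_mul_of_nonneg_right hDs hx2
      have f7 : K * (r / 2 * ‖x‖ ^ 2) ≤
          K * (x ⬝ᵥ ((1 / (K : ℝ)) • E K - R) *ᵥ x) + K * (x ⬝ᵥ R *ᵥ x) := by
        rw [← mul_add]
        exact mul_le_mul_of_nonneg_left (by linarith) (by linarith)
      have f8 : 0 ≤ c * ‖x‖ ^ 2 := by positivity
      have f9 : r * ‖x‖ ^ 2 * 1 ≤ r * ‖x‖ ^ 2 * K :=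
        mul_le_mul_of_nonneg_left hKge (by positivity)
      rw [hquad, e3]
      nlinarith
    have e5 := norm_le_of_coercive (by positivity) e4
    refine key _ ?_ e5
    have : N / (r / 8 * ((K : ℝ) + 1)) = C₁ * (1 / ((K : ℝ) + 1)) := by
      rw [hC₁]; field_simp
    rw [this]
    nlinarith [mul_nonneg h2 hi, mul_nonneg h3 hi, mul_nonneg h1 hs, mul_nonneg h2 hs,
      mul_nonneg h3 hs]
  -- For a large fluctuation `1 ≤ (8 / r * (D / (K + 1))) ^ 2`, so the bound from `Λ₀` may be
  -- multiplied by this square. The exponent two makes the term of order `1/K` once `D` is of order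
  -- `√K`.
  · refine key _ ?_ hcrude
    have h4 : N / c ≤ C₂ * (D / ((K : ℝ) + 1)) ^ 2 := by
      have h5 : 1 ≤ 8 / r * (D / ((K : ℝ) + 1)) := by
        rw [div_mul_eq_mul_div, le_div_iff₀ hr]; linarith
      have h6 : 1 ≤ (8 / r) ^ 2 * (D / ((K : ℝ) + 1)) ^ 2 := by
        rw [← mul_pow]; exact one_le_pow₀ h5
      rw [hC₂, mul_assoc]
      exact le_mul_of_one_le_right (by positivity) h6
    nlinarith [mul_nonneg h1 hi, mul_nonneg h2 hi, mul_nonneg h3 hi, mul_nonneg h1 hs,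
      mul_nonneg h3 hs]

end LeastSquares

/-! ### Martingale sums of noise times regressor. -/

section PredictableSums

/-- Sums of products of centred noise and predictable factors grow at the rate `√K`. -/
theorem hasMomentRate_sum_noise_mul {Ω : Type*} {mΩ : MeasurableSpace Ω} {μ : Measure Ω}
    [IsProbabilityMeasure μ] {F : ℕ → MeasurableSpace Ω}
    (hF : ∀ k, F k ≤ mΩ) (hmono : Monotone F) {d f : ℕ → Ω → ℝ}
    (hd : ∀ k, 1 ≤ k → Measurable[F (k + 1)] (d k)) (hf : ∀ k, 1 ≤ k → Measurable[F k] (f k))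
    (hind : ∀ k, 1 ≤ k → Indep (MeasurableSpace.comap (d k) inferInstance) (F k) μ)
    (hmean : ∀ k, 1 ≤ k → ∫ ω, d k ω ∂μ = 0)
    (hdr : HasMomentRate μ (fun k => d (k + 1)) (fun _ => 1))
    (hfr : HasMomentRate μ (fun k => f (k + 1)) (fun _ => 1)) :
    HasMomentRate μ (fun (K : ℕ) ω => ∑ l ∈ Finset.Icc 1 K, d l ω * f l ω)
      (fun K => Real.sqrt (K + 1)) := by
  have hD : HasMomentRate μ (fun k ω => d (k + 1) ω * f (k + 1) ω) (fun _ => 1) := by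
    simpa using hdr.mul hfr fun _ => zero_le_one
  have hSm : ∀ (K p : ℕ), MemLp (fun ω => ∑ l ∈ Finset.Icc 1 K, d l ω * f l ω) p μ := by
    intro K p
    refine memLp_finsetSum _ (f := fun l ω => d l ω * f l ω) fun l hl => ?_
    obtain ⟨k, rfl⟩ : ∃ k, l = k + 1 := ⟨l - 1, by rw [Finset.mem_Icc] at hl; omega⟩
    exact hD.memLp k p
  refine HasMomentRate.of_integral_even_pow_le (fun K => Real.sqrt_nonneg _) hSm fun m hm => ?_
  obtain ⟨b, hb, hb'⟩ := hD.integral_pow_le (fun _ => zero_le_one) (p := 2 * m) (by omega)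
  refine ⟨2 * 2 ^ (2 * m) * b * Real.exp (2 ^ (2 * m)), fun K => ?_⟩
  have hn' : (1 : ℝ) ≤ (K + 1 : ℕ) := by exact_mod_cast Nat.le_add_left 1 K
  have main : ∀ j : ℕ, ∫ ω, (∑ l ∈ Finset.Icc 1 j, d l ω * f l ω) ^ (2 * m) ∂μ ≤
      (j : ℝ) * ((2 * 2 ^ (2 * m) * b) * ((K + 1 : ℕ) : ℝ) ^ (m - 1)) *
        (1 + 2 ^ (2 * m) / ((K + 1 : ℕ) : ℝ)) ^ j := by
    intro j
    induction j with
    | zero => simp [show m ≠ 0 by omega]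
    | succ j ih =>
      have hmeas : Measurable[F (j + 1)] (fun ω => ∑ l ∈ Finset.Icc 1 j, d l ω * f l ω) := by
        refine Finset.measurable_fun_sum _ fun l hl => ?_
        have hl' := Finset.mem_Icc.1 hl
        exact ((hd l hl'.1).mono (hmono (by omega)) le_rfl).mul
          ((hf l hl'.1).mono (hmono (by omega)) le_rfl)
      -- The partial sum and the next factor `f (j + 1)` are known at stage `j + 1`, while `d (j +
      -- 1)` is independent of that stage and centred.
      have horth : ∫ ω, (∑ l ∈ Finset.Icc 1 j, d l ω * f l ω) ^ (2 * m - 1) *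
          (d (j + 1) ω * f (j + 1) ω) ∂μ = 0 := by
        have hd' : Measurable (d (j + 1)) := (hd (j + 1) (by omega)).mono (hF _) le_rfl
        have := integral_mul_eq_zero_of_indep (hF (j + 1)) hd'.comap_le
          (hind (j + 1) (by omega)).symm
          ((hmeas.pow_const (2 * m - 1)).mul (hf (j + 1) (by omega)))
          (comap_measurable (d (j + 1))) (hmean (j + 1) (by omega))
        rw [← this]
        refine integral_congr_ae (ae_of_all _ fun ω => ?_)
        simp only [Pi.mul_apply]
        ring
      have step := integral_add_pow_even_le (hSm j) (hD.memLp j) hm hn' horth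
      have hDb : ∫ ω, (d (j + 1) ω * f (j + 1) ω) ^ (2 * m) ∂μ ≤ b := by
        have := hb' j
        simp only [(even_two_mul m).pow_abs, one_pow, mul_one] at this
        exact this
      simp_rw [Finset.sum_Icc_succ_top (Nat.le_add_left 1 j)]
      refine growth_step j (by positivity) (by positivity) ih (step.trans ?_)
      have := mul_le_mul_of_nonneg_left hDb
        (by positivity : (0 : ℝ) ≤ 2 * 2 ^ (2 * m) * ((K + 1 : ℕ) : ℝ) ^ (m - 1))
      linarith
  refine (growth_bound hm (by omega) (Nat.le_succ K) (by positivity) (by positivity)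
    (main K)).trans_eq ?_
  rw [pow_mul (Real.sqrt _), Real.sq_sqrt (by positivity)]
  push_cast
  ring

end PredictableSums

/-! ### Rates for the local estimate and its increments. -/

section LeastSquaresMoments

variable {Ω : Type*} [MeasurableSpace Ω] {μ : Measure Ω} {N : ℕ}

theorem norm_le_sum_abs (v : Fin N → ℝ) : ‖v‖ ≤ ∑ i, |v i| :=
  (pi_norm_le_iff_of_nonneg (Finset.sum_nonneg fun _ _ => abs_nonneg _)).2 fun i =>
    Finset.single_le_sum (f := fun i => |v i|) (fun _ _ => abs_nonneg _) (Finset.mem_univ i)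

section Measurability

variable {φ : Ω → ℕ → Fin N → ℝ} {y : Ω → ℤ → ℝ}

theorem measurable_mulVec {A : Ω → Matrix (Fin N) (Fin N) ℝ} {v : Ω → Fin N → ℝ}
    (hA : ∀ i j, Measurable fun ω => A ω i j) (hv : ∀ i, Measurable fun ω => v ω i) (i : Fin N) :
    Measurable fun ω => (A ω *ᵥ v ω) i :=
  Finset.measurable_fun_sum Finset.univ (f := fun j ω => A ω i j * v ω j)
    fun j _ => (hA i j).mul (hv j)

theorem measurable_dotProduct {v w : Ω → Fin N → ℝ}
    (hv : ∀ i, Measurable fun ω => v ω i) (hw : ∀ i, Measurable fun ω => w ω i) :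
    Measurable fun ω => v ω ⬝ᵥ w ω :=
  Finset.measurable_fun_sum Finset.univ (f := fun j ω => v ω j * w ω j)
    fun j _ => (hv j).mul (hw j)

theorem measurable_gain {A : Ω → Matrix (Fin N) (Fin N) ℝ} {v : Ω → Fin N → ℝ}
    (hA : ∀ i j, Measurable fun ω => A ω i j) (hv : ∀ i, Measurable fun ω => v ω i) :
    Measurable fun ω => gain (A ω) (v ω) :=
  (measurable_const.add (measurable_dotProduct hv (measurable_mulVec hA hv))).inv

theorem measurable_covMat (hφ : ∀ k i, Measurable fun ω => φ ω k i)
    (P₀ : Matrix (Fin N) (Fin N) ℝ) (k : ℕ) (i j : Fin N) :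
    Measurable fun ω => covMat (φ ω) P₀ k i j := by
  induction k generalizing i j with
  | zero => exact measurable_const
  | succ k ih =>
    simp only [covMat, Matrix.sub_apply, Matrix.smul_apply, Matrix.mul_apply,
      Matrix.vecMulVec_apply, smul_eq_mul]
    refine (ih i j).sub ((measurable_gain ih (hφ _)).mul ?_)
    refine Finset.measurable_fun_sum _ fun l _ => Measurable.mul ?_ (ih l j)
    exact Finset.measurable_fun_sum _ fun l' _ => (ih i l').mul ((hφ _ _).mul (hφ _ _))

theorem measurable_rlsEst (hφ : ∀ k i, Measurable fun ω => φ ω k i)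
    (hy : ∀ k : ℕ, Measurable fun ω => y ω k) (P₀ : Matrix (Fin N) (Fin N) ℝ) (θ₀ : Fin N → ℝ)
    (k : ℕ) (i : Fin N) : Measurable fun ω => rlsEst (φ ω) (y ω) P₀ θ₀ k i := by
  induction k generalizing i with
  | zero => exact measurable_const
  | succ k ih =>
    simp only [rlsEst, Pi.add_apply, Pi.smul_apply, smul_eq_mul]
    exact (ih i).add (((measurable_gain (measurable_covMat hφ P₀ k) (hφ _)).mul
      ((hy (k + 1)).sub (measurable_dotProduct (hφ _) ih))).mul
        (measurable_mulVec (measurable_covMat hφ P₀ k) (hφ _) i))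

end Measurability

variable [IsProbabilityMeasure μ]

/-- Moment rates of the least-squares error and of its increments. -/
theorem hasMomentRate_rlsEst [NeZero N] {φ : Ω → ℕ → Fin N → ℝ} {y : Ω → ℤ → ℝ} {d : ℕ → Ω → ℝ}
    {θ θ₀ : Fin N → ℝ} {P₀ R : Matrix (Fin N) (Fin N) ℝ} {E : ℕ → Matrix (Fin N) (Fin N) ℝ}
    (hφm : ∀ k i, Measurable fun ω => φ ω k i) (hym : ∀ k : ℕ, Measurable fun ω => y ω k)
    (hy : ∀ ω, ∀ k : ℕ, 1 ≤ k → y ω k = φ ω k ⬝ᵥ θ + d k ω)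
    (hφ : ∀ i, HasMomentRate μ (fun k ω => φ ω k i) (fun _ => 1))
    (hd : HasMomentRate μ (fun k => d (k + 1)) (fun _ => 1))
    (hgram : ∀ i j, HasMomentRate μ (fun K ω => gram (φ ω) K i j - E K i j)
      (fun K => Real.sqrt (K + 1)))
    (hM : ∀ i, HasMomentRate μ (fun (K : ℕ) ω => ∑ l ∈ Finset.Icc 1 K, d l ω * φ ω l i)
      (fun K => Real.sqrt (K + 1)))
    (hP₀ : P₀.PosDef) (hR : R.PosDef)
    (hE : ∀ i j, Tendsto (fun K : ℕ => 1 / (K : ℝ) * E K i j) atTop (𝓝 (R i j))) :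
    (∀ i, HasMomentRate μ (fun k ω => rlsEst (φ ω) (y ω) P₀ θ₀ k i - θ i)
      (fun k => 1 / Real.sqrt (k + 1))) ∧
    ∀ i, HasMomentRate μ
      (fun k ω => rlsEst (φ ω) (y ω) P₀ θ₀ (k + 1) i - rlsEst (φ ω) (y ω) P₀ θ₀ k i)
      (fun k => 1 / ((k : ℝ) + 1)) := by
  obtain ⟨c, hc, hc'⟩ := hP₀.inv.exists_coercive
  have hΛ : ∀ x, 0 ≤ x ⬝ᵥ P₀⁻¹ *ᵥ x := fun x => le_trans (by positivity) (hc' x)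
  have h₀ : P₀⁻¹ * P₀ = 1 := Matrix.nonsing_inv_mul _ ((Matrix.isUnit_iff_isUnit_det _).1 hP₀.isUnit)
  obtain ⟨C, hC, hb⟩ := exists_information_lower_bound hR hP₀.inv hE
  have hs0 : ∀ k : ℕ, 0 ≤ Real.sqrt ((k : ℝ) + 1) := fun k => Real.sqrt_nonneg _
  -- A random bound on the norm of the inverse information matrix, of order `1/K` in every `L^p`.
  set ρ : ℕ → Ω → ℝ := fun K ω => C * (1 / ((K : ℝ) + 1) +
    (1 / ((K : ℝ) + 1) * ∑ i, ∑ j, |gram (φ ω) K i j - E K i j|) ^ 2) with hρ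
  have hρ0 : ∀ K ω, 0 ≤ ρ K ω := fun K ω => by positivity
  have hb' : ∀ ω K x, ‖x‖ ≤ ρ K ω * ‖(P₀⁻¹ + gram (φ ω) K) *ᵥ x‖ := by
    intro ω K x
    refine (hb (φ ω) K x).trans_eq ?_
    simp only [hρ, one_div_mul_eq_div]
  have hρr : HasMomentRate μ ρ (fun K => 1 / ((K : ℝ) + 1)) := by
    refine HasMomentRate.const_mul (HasMomentRate.add ?_ ?_ fun K => by positivity) C
    · exact HasMomentRate.of_le_const zero_le_one fun K => by
        rw [one_mul, abs_of_nonneg (by positivity)]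
    · have h1 := ((HasMomentRate.finset_sum Finset.univ (fun i _ =>
        HasMomentRate.finset_sum Finset.univ (fun j _ => (hgram i j).abs) hs0) hs0).weight_mul
          fun K : ℕ => 1 / ((K : ℝ) + 1)).pow (fun K => by positivity) 2
      refine h1.of_weight_le zero_le_one fun K => le_of_eq ?_
      rw [mul_pow, sq_abs, Real.sq_sqrt (by positivity)]
      field_simp
  have hVr : HasMomentRate μ (fun K ω => ‖P₀⁻¹ *ᵥ (θ₀ - θ)‖ +
      ∑ i, |∑ l ∈ Finset.Icc 1 K, d l ω * φ ω l i|) (fun K => Real.sqrt (K + 1)) := by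
    refine HasMomentRate.add ?_ (HasMomentRate.finset_sum _ (fun i _ => (hM i).abs) hs0) hs0
    refine HasMomentRate.of_le_const (norm_nonneg (P₀⁻¹ *ᵥ (θ₀ - θ))) fun K => ?_
    rw [abs_of_nonneg (norm_nonneg _)]
    refine le_mul_of_one_le_right (norm_nonneg _) (Real.one_le_sqrt.2 ?_)
    linarith [Nat.cast_nonneg (α := ℝ) K]
  have herr : ∀ ω K, ‖rlsEst (φ ω) (y ω) P₀ θ₀ K - θ‖ ≤ ρ K ω * (‖P₀⁻¹ *ᵥ (θ₀ - θ)‖ +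
      ∑ i, |∑ l ∈ Finset.Icc 1 K, d l ω * φ ω l i|) := by
    intro ω K
    refine (hb' ω K _).trans (mul_le_mul_of_nonneg_left ?_ (hρ0 K ω))
    rw [information_mulVec_rlsEst_sub hΛ h₀ (hy ω)]
    refine (norm_add_le _ _).trans (add_le_add_right ((norm_le_sum_abs _).trans_eq ?_) _)
    simp
  have hmeas := measurable_rlsEst hφm hym P₀ θ₀
  have hfirst : ∀ i, HasMomentRate μ (fun k ω => rlsEst (φ ω) (y ω) P₀ θ₀ k i - θ i)
      (fun k => 1 / Real.sqrt (k + 1)) := by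
    intro i
    have h1 := (hρr.mul hVr fun K => by positivity).of_weight_le
      (g := fun k : ℕ => 1 / Real.sqrt (k + 1)) zero_le_one (fun K => by
        have h2 : 0 < Real.sqrt ((K : ℝ) + 1) := Real.sqrt_pos.2 (by positivity)
        have h3 := Real.mul_self_sqrt (by positivity : (0 : ℝ) ≤ (K : ℝ) + 1)
        rw [one_mul, div_mul_eq_mul_div, one_mul, div_le_div_iff₀ (by positivity) h2, h3, one_mul])
    refine h1.of_abs_le (fun k => ((hmeas k i).sub_const _).aestronglyMeasurable)
      fun k => ae_of_all _ fun ω => ?_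
    exact (norm_le_pi_norm (rlsEst (φ ω) (y ω) P₀ θ₀ k - θ) i).trans
      ((herr ω k).trans (le_abs_self _))
  refine ⟨hfirst, fun i => ?_⟩
  have hone : ∀ _k : ℕ, (0 : ℝ) ≤ 1 := fun _ => zero_le_one
  have hF : HasMomentRate μ (fun k ω => ∑ i, |φ ω (k + 1) i|) (fun _ => 1) :=
    HasMomentRate.finset_sum _ (fun i _ => ((hφ i).comp fun k => k + 1).abs) hone
  have hU : HasMomentRate μ (fun k ω => ∑ i, |rlsEst (φ ω) (y ω) P₀ θ₀ k i - θ i|) (fun _ => 1) := by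
    refine HasMomentRate.finset_sum _ (fun i _ => ((hfirst i).abs).of_weight_le zero_le_one
      fun k => ?_) hone
    rw [one_mul]
    refine div_le_one_of_le₀ (Real.one_le_sqrt.2 ?_) (Real.sqrt_nonneg _)
    linarith [Nat.cast_nonneg (α := ℝ) k]
  -- An update is the product of a gain in `[0, 1]`, an innovation of order `1`, and the vector `P_k
  -- φ_{k+1}` of order `1/k`.
  have h1 := (hd.abs.add ((hF.mul hU hone).of_weight_le (g := fun _ => 1) zero_le_one
    (fun _ => by norm_num) |>.const_mul (N : ℝ)) hone).mul
      (hρr.mul hF fun k => by positivity) hone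
  refine (h1.of_weight_le (g := fun k : ℕ => 1 / ((k : ℝ) + 1)) zero_le_one
    fun k => by simp).of_abs_le
    (fun k => ((hmeas (k + 1) i).sub (hmeas k i)).aestronglyMeasurable)
    fun k => ae_of_all _ fun ω => ?_
  set w := rlsEst (φ ω) (y ω) P₀ θ₀ k with hw
  set v := φ ω (k + 1) with hv
  have hstep : rlsEst (φ ω) (y ω) P₀ θ₀ (k + 1) i - w i =
      gain (covMat (φ ω) P₀ k) v * (d (k + 1) ω - v ⬝ᵥ (w - θ)) * (covMat (φ ω) P₀ k *ᵥ v) i := by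
    rw [rlsEst, hy ω (k + 1) (by omega), Pi.add_apply, Pi.smul_apply, smul_eq_mul, dotProduct_sub]
    ring
  obtain ⟨g0, g1⟩ := gain_nonneg_le_one (φ := φ ω) hΛ h₀ k v
  have hvF : ‖v‖ ≤ ∑ i, |v i| := norm_le_sum_abs v
  have hwU : ‖w - θ‖ ≤ ∑ i, |w i - θ i| := norm_le_sum_abs (w - θ)
  have hPv : |(covMat (φ ω) P₀ k *ᵥ v) i| ≤ ρ k ω * ∑ i, |v i| := by
    refine (norm_le_pi_norm (covMat (φ ω) P₀ k *ᵥ v) i).trans ((hb' ω k _).trans ?_)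
    rw [information_mulVec_covMat hΛ h₀]
    exact mul_le_mul_of_nonneg_left hvF (hρ0 _ _)
  have hinn : |d (k + 1) ω - v ⬝ᵥ (w - θ)| ≤
      |d (k + 1) ω| + N * ((∑ i, |v i|) * ∑ i, |w i - θ i|) := by
    refine (abs_sub _ _).trans (add_le_add_right ((abs_dotProduct_le _ _).trans ?_) _)
    gcongr
  refine le_trans ?_ (le_abs_self _)
  rw [hstep, abs_mul, abs_mul, abs_of_nonneg g0]
  refine mul_le_mul ?_ hPv (abs_nonneg _) (by positivity)
  calc _ ≤ 1 * |d (k + 1) ω - v ⬝ᵥ (w - θ)| := by gcongr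
    _ ≤ _ := by rw [one_mul]; exact hinn

end LeastSquaresMoments

/-! ### Pathwise behaviour of sign steps in one coordinate. -/

section Tracking

variable {N : ℕ} [NeZero N]

/-- The displacement of component `i` at time `k`. -/
noncomputable def stepSize (α : ℝ) (β : ℕ → ℝ) (i : Fin N) (k : ℕ) : ℝ :=
  if Fin.ofNat N k = i then β k / (k : ℝ) ^ α else 0

theorem remoteEst_succ_apply (w : ℕ → Fin N → ℝ) (α : ℝ) (β : ℕ → ℝ) (θ₀ : Fin N → ℝ) (k : ℕ)
    (i : Fin N) :
    remoteEst w α β θ₀ (k + 1) i = remoteEst w α β θ₀ k i +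
      stepSize α β i (k + 1) * if remoteEst w α β θ₀ k i < w (k + 1) i then 1 else -1 := by
  rw [remoteEst, Pi.add_apply, Pi.smul_apply, smul_eq_mul, oneBit, direction, stepSize,
    single_one_dotProduct, single_one_dotProduct]
  by_cases h : Fin.ofNat N (k + 1) = i
  · subst h
    simp only [Pi.single_eq_same, mul_one, if_true, gt_iff_lt]
    ring
  · rw [Pi.single_eq_of_ne (Ne.symm h), if_neg h]
    simp

/-- A step towards `w` that does not bring `v` closer to `θ` by the full amount either crosses `θ`,
ending within `ε` of it, or moves away from `θ`, in which case `w` lies at least as far from `θ` as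
`v` on that side. -/
theorem abs_sub_step_le {v w θ ε : ℝ} (hε : 0 ≤ ε) :
    |v + ε * (if v < w then 1 else -1) - θ| ≤ max (|v - θ| - ε) (|w - θ| + ε) := by
  rw [le_max_iff]
  split_ifs with h
  · rcases le_total 0 (v - θ) with h1 | h1
    · right
      rw [abs_of_nonneg (by linarith)]
      linarith [le_abs_self (w - θ)]
    · rcases le_total 0 (v - θ + ε) with h2 | h2
      · right
        rw [abs_of_nonneg (by linarith)]
        linarith [abs_nonneg (w - θ)]
      · left
        rw [abs_of_nonpos (by linarith), abs_of_nonpos h1]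
        linarith
  · rcases le_total 0 (v - θ) with h1 | h1
    · rcases le_total 0 (v - θ - ε) with h2 | h2
      · left
        rw [abs_of_nonneg (by linarith), abs_of_nonneg h1]
        linarith
      · right
        rw [abs_of_nonpos (by linarith)]
        linarith [abs_nonneg (w - θ)]
    · right
      rw [abs_of_nonpos (by linarith)]
      linarith [neg_abs_le (w - θ)]

/-- The index `j` is the last time the second alternative of the maximum was taken, or `0`; every
step after it reduces `E` in full. -/
theorem exists_le_sub_sum {E Y ε : ℕ → ℝ} (h0 : E 0 ≤ Y 0)
    (h : ∀ k, E (k + 1) ≤ max (E k - ε (k + 1)) (Y (k + 1))) (k : ℕ) :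
    ∃ j ≤ k, E k ≤ Y j - ∑ l ∈ Finset.Ioc j k, ε l := by
  induction k with
  | zero => exact ⟨0, le_rfl, by simpa using h0⟩
  | succ k ih =>
    rcases le_max_iff.1 (h k) with h1 | h1
    · obtain ⟨j, hj, hE⟩ := ih
      refine ⟨j, by omega, ?_⟩
      rw [Finset.sum_Ioc_succ_top hj]
      linarith
    · exact ⟨k + 1, le_rfl, by simpa using h1⟩

/-- A residue class meets the interval at least `(k - j) / N - 1` times, and `k - j ≥ 2N` lets half
of the main term absorb the `1`. -/
theorem half_div_le_card_residue {j k : ℕ} (hjk : j + 2 * N ≤ k) (i : Fin N) :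
    ((k : ℝ) - j) / (2 * N) ≤ ((Finset.Ioc j k).filter fun l => Fin.ofNat N l = i).card := by
  have hN : 0 < N := Nat.pos_of_ne_zero (NeZero.ne N)
  have hN' : (0 : ℚ) < N := by exact_mod_cast hN
  have hfilter : ((Finset.Ioc j k).filter fun l => Fin.ofNat N l = i) =
      (Finset.Ioc j k).filter fun l => l ≡ (i : ℕ) [MOD N] := by
    refine Finset.filter_congr fun l _ => ?_
    rw [Fin.ext_iff, Fin.val_ofNat, Nat.ModEq, Nat.mod_eq_of_lt i.2]
  have hcard := Nat.Ioc_filter_modEq_card j k hN (i : ℕ)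
  have h1 := Int.lt_floor_add_one (((k : ℚ) - (i : ℕ)) / N)
  have h2 := Int.floor_le (((j : ℚ) - (i : ℕ)) / N)
  have h3 : ((k : ℚ) - j) / (2 * N) ≤
      ((Finset.Ioc j k).filter fun l => Fin.ofNat N l = i).card := by
    rw [hfilter]
    have h4 : (((Finset.Ioc j k).filter fun l => l ≡ (i : ℕ) [MOD N]).card : ℚ) ≥
        ((⌊((k : ℚ) - (i : ℕ)) / N⌋ - ⌊((j : ℚ) - (i : ℕ)) / N⌋ : ℤ) : ℚ) := by
      have : (⌊((k : ℚ) - (i : ℕ)) / N⌋ - ⌊((j : ℚ) - (i : ℕ)) / N⌋ : ℤ) ≤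
        (((Finset.Ioc j k).filter fun l => l ≡ (i : ℕ) [MOD N]).card : ℤ) := by
        rw [hcard]; exact le_max_left _ _
      exact_mod_cast this
    refine le_trans ?_ h4
    push_cast
    have h5 : ((k : ℚ) - (i : ℕ)) / N - ((j : ℚ) - (i : ℕ)) / N = ((k : ℚ) - j) / N := by ring
    have h6 : 1 ≤ ((k : ℚ) - j) / (2 * N) := by
      rw [le_div_iff₀ (by positivity)]
      have : (j : ℚ) + 2 * N ≤ k := by exact_mod_cast hjk
      linarith
    have h7 : ((k : ℚ) - j) / N = 2 * (((k : ℚ) - j) / (2 * N)) := by field_simp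
    linarith
  have h8 : ((((k : ℚ) - j) / (2 * N) : ℚ) : ℝ) ≤
      ((((Finset.Ioc j k).filter fun l => Fin.ofNat N l = i).card : ℚ) : ℝ) := by
    exact_mod_cast h3
  push_cast at h8
  exact h8

variable {α : ℝ} {β : ℕ → ℝ} {βlow βhigh : ℝ}

theorem stepSize_nonneg (hβlow : 0 < βlow) (hβ : ∀ k : ℕ, 1 ≤ k → βlow ≤ β k ∧ β k ≤ βhigh)
    (i : Fin N) {k : ℕ} (hk : 1 ≤ k) : 0 ≤ stepSize α β i k := by
  rw [stepSize]
  split_ifs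
  · exact div_nonneg (hβlow.le.trans (hβ k hk).1) (by positivity)
  · exact le_rfl

theorem sum_stepSize_ge (hα : 0 ≤ α) (hβlow : 0 < βlow)
    (hβ : ∀ k : ℕ, 1 ≤ k → βlow ≤ β k ∧ β k ≤ βhigh)
    (i : Fin N) {j k : ℕ} (hjk : j + 2 * N ≤ k) :
    βlow / (2 * N) * (((k : ℝ) - j) / (k : ℝ) ^ α) ≤ ∑ l ∈ Finset.Ioc j k, stepSize α β i l := by
  have hN : 0 < N := Nat.pos_of_ne_zero (NeZero.ne N)
  have hk : (0 : ℝ) < k := by exact_mod_cast (by omega : 0 < k)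
  simp only [stepSize]
  rw [← Finset.sum_filter]
  have h1 : ∀ l ∈ (Finset.Ioc j k).filter fun l => Fin.ofNat N l = i,
      βlow / (k : ℝ) ^ α ≤ β l / (l : ℝ) ^ α := by
    intro l hl
    have hl' := Finset.mem_Ioc.1 (Finset.mem_filter.1 hl).1
    have hl0 : (0 : ℝ) < l := by exact_mod_cast (by omega : 0 < l)
    have hlk : (l : ℝ) ≤ k := by exact_mod_cast hl'.2
    have hb := (hβ l (by omega)).1
    have := Real.rpow_pos_of_pos hl0 α
    have := hβlow.le.trans hb
    gcongr
  have h2 := Finset.card_nsmul_le_sum _ _ _ h1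
  refine le_trans ?_ h2
  rw [nsmul_eq_mul]
  have h3 := mul_le_mul_of_nonneg_right (half_div_le_card_residue hjk i)
    (by positivity : 0 ≤ βlow / (k : ℝ) ^ α)
  refine le_trans (le_of_eq ?_) h3
  ring

theorem sqrt_succ_le (j : ℕ) (hj : 1 ≤ j) : Real.sqrt ((j : ℝ) + 1) ≤ 2 * Real.sqrt j := by
  have hj' : (1 : ℝ) ≤ j := by exact_mod_cast hj
  rw [Real.sqrt_le_left (by positivity), mul_pow, Real.sq_sqrt (by positivity)]
  linarith

theorem stepSize_le (hα : 1 / 2 < α) (hβlow : 0 < βlow)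
    (hβ : ∀ k : ℕ, 1 ≤ k → βlow ≤ β k ∧ β k ≤ βhigh)
    (i : Fin N) {j : ℕ} (hj : 1 ≤ j) :
    stepSize α β i j ≤ 2 * βhigh * (1 / Real.sqrt ((j : ℝ) + 1)) := by
  have hj' : (1 : ℝ) ≤ j := by exact_mod_cast hj
  have hβh : 0 ≤ βhigh := hβlow.le.trans ((hβ j hj).1.trans (hβ j hj).2)
  rw [stepSize]
  split_ifs
  · have h1 : Real.sqrt j ≤ (j : ℝ) ^ α := by
      rw [Real.sqrt_eq_rpow]
      exact Real.rpow_le_rpow_of_exponent_le hj' hα.le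
    have h2 : 0 < Real.sqrt (j : ℝ) := Real.sqrt_pos.2 (by linarith)
    have h3 := sqrt_succ_le j hj
    have h4 : 0 < Real.sqrt ((j : ℝ) + 1) := Real.sqrt_pos.2 (by linarith)
    calc β j / (j : ℝ) ^ α ≤ βhigh / Real.sqrt j := by
          have := (hβ j hj).2
          gcongr
      _ ≤ 2 * βhigh * (1 / Real.sqrt ((j : ℝ) + 1)) := by
          rw [mul_one_div, div_le_div_iff₀ h2 h4]
          nlinarith
  · positivity

/-- For `j ≤ k/2` the gap `k - j` alone has order `k`; for larger `j` both factors have order at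
least `√k`. This is what a window of length `√k` buys: outside it, the accumulated steps compared
with the local error `1/√(j+1)` are of order at least `k ^ (1 - α)`. -/
theorem half_le_sqrt_mul_sub {j k : ℕ} (hjk : j + Nat.sqrt k < k) :
    (k : ℝ) / 2 ≤ Real.sqrt ((j : ℝ) + 1) * ((k : ℝ) - j) := by
  have hj0 : (0 : ℝ) ≤ j := Nat.cast_nonneg j
  have hkj : (j : ℝ) < k := by exact_mod_cast (by omega : j < k)
  rcases le_total (2 * j) k with h | h
  · have h1 : 1 ≤ Real.sqrt ((j : ℝ) + 1) := Real.one_le_sqrt.2 (by linarith)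
    have h2 : 2 * (j : ℝ) ≤ k := by exact_mod_cast h
    nlinarith
  · have h1 : Real.sqrt k ≤ (k : ℝ) - j := by
      have h2 : (Nat.sqrt k : ℝ) + 1 ≤ (k : ℝ) - j := by
        have : ((j + Nat.sqrt k + 1 : ℕ) : ℝ) ≤ k := by exact_mod_cast hjk
        push_cast at this
        linarith
      refine le_trans ?_ h2
      rw [Real.sqrt_le_left (by positivity)]
      exact_mod_cast (by have := Nat.lt_succ_sqrt k; rw [pow_two]; exact this.le)
    have h3 : Real.sqrt k / 2 ≤ Real.sqrt ((j : ℝ) + 1) := by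
      refine Real.le_sqrt_of_sq_le ?_
      rw [div_pow, Real.sq_sqrt (by positivity)]
      have : (k : ℝ) ≤ 2 * j := by exact_mod_cast h
      linarith
    have h4 := Real.mul_self_sqrt (Nat.cast_nonneg (α := ℝ) k)
    calc (k : ℝ) / 2 = Real.sqrt k / 2 * Real.sqrt k := by rw [div_mul_eq_mul_div, h4]
      _ ≤ _ := mul_le_mul h3 h1 (Real.sqrt_nonneg _) (Real.sqrt_nonneg _)

/-- Here `α < 1` pays off: a large power `q` turns the gain `k ^ (α - 1)` into `k ^ (-3/2)`, so that
a sum of up to `k` such terms is of order `1/√k`. -/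
theorem rpow_div_pow_le {α : ℝ} {q : ℕ} (hq : 3 / 2 ≤ (1 - α) * q) {k : ℕ} (hk : 1 ≤ k) :
    ((k : ℝ) ^ α / k) ^ q ≤ 1 / (k * Real.sqrt k) := by
  have hk' : (1 : ℝ) ≤ k := by exact_mod_cast hk
  have hk0 : (0 : ℝ) < k := by linarith
  have e1 : (k : ℝ) ^ α / k = (k : ℝ) ^ (α - 1) := by rw [Real.rpow_sub_one hk0.ne']
  have e2 : 1 / (k * Real.sqrt k) = (k : ℝ) ^ (-(3 / 2) : ℝ) := by
    rw [Real.rpow_neg hk0.le, Real.sqrt_eq_rpow, one_div, show (3 / 2 : ℝ) = 1 + 1 / 2 by norm_num,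
      Real.rpow_add hk0, Real.rpow_one]
  rw [e1, e2, ← Real.rpow_mul_natCast hk0.le]
  exact Real.rpow_le_rpow_of_exponent_le hk' (by linarith)

end Tracking

/-! ### From pathwise tracking to moment rates of the remote estimate. -/

section RemoteMoments

variable {Ω : Type*} [MeasurableSpace Ω] {μ : Measure Ω} {N : ℕ} [NeZero N]

theorem measurable_remoteEst {w : Ω → ℕ → Fin N → ℝ} (hw : ∀ k i, Measurable fun ω => w ω k i)
    (α : ℝ) (β : ℕ → ℝ) (θ₀ : Fin N → ℝ) (k : ℕ) (i : Fin N) :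
    Measurable fun ω => remoteEst (w ω) α β θ₀ k i := by
  induction k with
  | zero => exact measurable_const
  | succ k ih =>
    simp only [remoteEst_succ_apply]
    exact ih.add (measurable_const.mul
      (Measurable.ite (measurableSet_lt ih (hw _ _)) measurable_const measurable_const))

theorem abs_remoteEst_le {w : ℕ → Fin N → ℝ}
    (α : ℝ) (β : ℕ → ℝ) (θ₀ : Fin N → ℝ) (k : ℕ) (i : Fin N) :
    |remoteEst w α β θ₀ k i| ≤ |θ₀ i| + ∑ l ∈ Finset.Icc 1 k, |stepSize α β i l| := by
  induction k with
  | zero => simp [remoteEst]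
  | succ k ih =>
    rw [remoteEst_succ_apply, Finset.sum_Icc_succ_top (by omega)]
    refine (abs_add_le _ _).trans ?_
    have : |stepSize α β i (k + 1) * if remoteEst w α β θ₀ k i < w (k + 1) i then 1 else -1| ≤
        |stepSize α β i (k + 1)| := by
      rw [abs_mul]
      split_ifs <;> simp
    linarith

/-- Pathwise bound on the tracking error: the recent local errors, and a penalized sum of the
distant ones. -/
theorem abs_remoteEst_sub_le {α : ℝ} {β : ℕ → ℝ} {βlow βhigh : ℝ} (hα : 0 ≤ α)
    (hβlow : 0 < βlow) (hβ : ∀ k : ℕ, 1 ≤ k → βlow ≤ β k ∧ β k ≤ βhigh)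
    (w : ℕ → Fin N → ℝ) (θ θ₀ : Fin N → ℝ) (i : Fin N) {e : ℕ → ℝ}
    (he0 : |θ₀ i - θ i| ≤ e 0) (he : ∀ j, 1 ≤ j → stepSize α β i j ≤ e j) (he' : ∀ j, 0 ≤ e j)
    {b : ℝ} {k : ℕ} (hb : ∀ j, k ≤ j + Nat.sqrt k → e j ≤ b) (hk : 2 * N ≤ Nat.sqrt k) (q : ℕ) :
    |remoteEst w α β θ₀ k i - θ i| ≤
      (|w k i - θ i| + ∑ l ∈ Finset.Ico (k - Nat.sqrt k) k, |w (l + 1) i - w l i| + b) +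
      ∑ j ∈ Finset.range (k - Nat.sqrt k), (|w j i - θ i| + e j) ^ (q + 1) *
        ((βlow / (2 * N) * (((k : ℝ) - j) / (k : ℝ) ^ α)) ^ q)⁻¹ := by
  have hN : 0 < N := Nat.pos_of_ne_zero (NeZero.ne N)
  have hLk : Nat.sqrt k ≤ k := Nat.sqrt_le_self k
  have hk0 : (0 : ℝ) < k := by exact_mod_cast (by omega : 0 < k)
  have hb0 : 0 ≤ b := (he' k).trans (hb k (by omega))
  have hpen : ∀ j ∈ Finset.range (k - Nat.sqrt k),
      0 < βlow / (2 * N) * (((k : ℝ) - j) / (k : ℝ) ^ α) := by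
    intro j hj
    have hjk : (j : ℝ) < k := by
      rw [Finset.mem_range] at hj
      exact_mod_cast (by omega : j < k)
    have := sub_pos.2 hjk
    have := Real.rpow_pos_of_pos hk0 α
    positivity
  have hterm : ∀ j ∈ Finset.range (k - Nat.sqrt k), 0 ≤ (|w j i - θ i| + e j) ^ (q + 1) *
        ((βlow / (2 * N) * (((k : ℝ) - j) / (k : ℝ) ^ α)) ^ q)⁻¹ := by
    intro j hj
    have := he' j
    have := hpen j hj
    positivity
  obtain ⟨j, hjk, hj⟩ := exists_le_sub_sum (E := fun k => |remoteEst w α β θ₀ k i - θ i|)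
    (Y := fun j => |w j i - θ i| + e j) (ε := stepSize α β i)
    (by simp only [remoteEst]; linarith [abs_nonneg (w 0 i - θ i)])
    (fun k => by
      rw [remoteEst_succ_apply]
      refine (abs_sub_step_le (stepSize_nonneg hβlow hβ i (by omega))).trans
        (max_le_max le_rfl ?_)
      linarith [he (k + 1) (by omega)]) k
  -- The index `j` is random. Near `k` it is handled by telescoping to time `k`; far from `k`, by
  -- summing over all possible values.
  rcases le_or_gt k (j + Nat.sqrt k) with hnear | hfar
  · refine le_trans ?_ (le_add_of_nonneg_right (Finset.sum_nonneg hterm))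
    have hS : 0 ≤ ∑ l ∈ Finset.Ioc j k, stepSize α β i l := Finset.sum_nonneg fun l hl =>
      stepSize_nonneg hβlow hβ i (by rw [Finset.mem_Ioc] at hl; omega)
    have h1 : |w j i - w k i| ≤ ∑ l ∈ Finset.Ico (k - Nat.sqrt k) k, |w (l + 1) i - w l i| := by
      have h2 := dist_le_Ico_sum_dist (fun l => w l i) hjk
      rw [Real.dist_eq] at h2
      refine h2.trans ?_
      refine (Finset.sum_le_sum_of_subset_of_nonneg
        (Finset.Ico_subset_Ico_left (by omega : k - Nat.sqrt k ≤ j))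
        fun _ _ _ => dist_nonneg).trans_eq ?_
      exact Finset.sum_congr rfl fun l _ => by rw [dist_comm, Real.dist_eq]
    have h3 : |w j i - θ i| ≤ |w j i - w k i| + |w k i - θ i| := abs_sub_le _ _ _
    linarith [hb j hnear]
  · have hjmem : j ∈ Finset.range (k - Nat.sqrt k) := Finset.mem_range.2 (by omega)
    refine le_add_of_nonneg_of_le (add_nonneg (add_nonneg (abs_nonneg _)
      (Finset.sum_nonneg fun _ _ => abs_nonneg _)) hb0) ?_
    refine le_trans ?_ (Finset.single_le_sum hterm hjmem)
    have hs := sum_stepSize_ge hα hβlow hβ i (by omega : j + 2 * N ≤ k)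
    have hp := hpen j hjmem
    set s := βlow / (2 * N) * (((k : ℝ) - j) / (k : ℝ) ^ α) with hsdef
    -- The error at time `k` is nonnegative, so the quantity at time `j` must exceed the steps `s`
    -- taken since. Multiplying by `(Y / s) ^ q ≥ 1` then gives the penalized term.
    have hY : s ≤ |w j i - θ i| + e j := by
      linarith [abs_nonneg (remoteEst w α β θ₀ k i - θ i)]
    rw [← div_eq_mul_inv, le_div_iff₀ (by positivity), pow_succ, mul_comm]
    refine mul_le_mul (pow_le_pow_left₀ hp.le hY q) (by linarith) (abs_nonneg _) ?_
    exact pow_nonneg (hp.le.trans hY) q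

variable [IsProbabilityMeasure μ]

/-- The remote estimate inherits the moment rate of the local estimates. -/
theorem hasMomentRate_remoteEst {α : ℝ} {β : ℕ → ℝ} {βlow βhigh : ℝ} (hα : 1 / 2 < α)
    (hα' : α < 1) (hβlow : 0 < βlow) (hβ : ∀ k : ℕ, 1 ≤ k → βlow ≤ β k ∧ β k ≤ βhigh)
    {w : Ω → ℕ → Fin N → ℝ} (hw : ∀ k i, Measurable fun ω => w ω k i) {θ θ₀ : Fin N → ℝ}
    (i : Fin N)
    (hrate : HasMomentRate μ (fun k ω => w ω k i - θ i) (fun k => 1 / Real.sqrt (k + 1)))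
    (hinc : HasMomentRate μ (fun k ω => w ω (k + 1) i - w ω k i) (fun k => 1 / ((k : ℝ) + 1)))
    {k₀ : ℕ} (hk₀ : (2 * N) ^ 2 ≤ k₀) :
    HasMomentRate μ (fun n ω => remoteEst (w ω) α β θ₀ (n + k₀) i - θ i)
      (fun n => 1 / Real.sqrt (((n + k₀ : ℕ) : ℝ) + 1)) := by
  have hN : 0 < N := Nat.pos_of_ne_zero (NeZero.ne N)
  have hsq : ∀ k : ℕ, 0 < Real.sqrt ((k : ℝ) + 1) := fun k => Real.sqrt_pos.2 (by positivity)
  have hr0 : ∀ k : ℕ, 0 ≤ 1 / Real.sqrt ((k : ℝ) + 1) := fun k => by positivity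
  have hβh : 0 ≤ βhigh := hβlow.le.trans ((hβ 1 le_rfl).1.trans (hβ 1 le_rfl).2)
  obtain ⟨q, hq⟩ := exists_nat_ge (3 / 2 / (1 - α))
  have hq' : 3 / 2 ≤ (1 - α) * q := by
    rw [div_le_iff₀ (by linarith)] at hq; linarith
  -- Large enough for `e` to dominate every step size, as well as the initial error at `j = 0`.
  set c : ℝ := 2 * βhigh + |θ₀ i - θ i| with hc
  have hc0 : 0 ≤ c := by positivity
  set e : ℕ → ℝ := fun j => c * (1 / Real.sqrt ((j : ℝ) + 1)) with he
  have he' : ∀ j, 0 ≤ e j := fun j => mul_nonneg hc0 (hr0 j)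
  have he0 : |θ₀ i - θ i| ≤ e 0 := by simp [he, hc]; positivity
  have hes : ∀ j, 1 ≤ j → stepSize α β i j ≤ e j := fun j hj =>
    (stepSize_le hα hβlow hβ i hj).trans (mul_le_mul_of_nonneg_right
      (le_add_of_nonneg_right (abs_nonneg _)) (hr0 j))
  have hlarge : ∀ n : ℕ, 2 * N ≤ Nat.sqrt (n + k₀) := fun n =>
    Nat.le_sqrt'.2 (by omega)
  have hbig : ∀ n : ℕ, 4 ≤ n + k₀ := fun n => by nlinarith
  have hL : ∀ n : ℕ, 2 * Nat.sqrt (n + k₀) ≤ n + k₀ := by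
    intro n
    have h1 := Nat.sqrt_le (n + k₀)
    have h2 := hlarge n
    nlinarith
  have hbd : ∀ (n j : ℕ), n + k₀ ≤ j + Nat.sqrt (n + k₀) →
      e j ≤ 2 * c * (1 / Real.sqrt (((n + k₀ : ℕ) : ℝ) + 1)) := by
    intro n j hj
    have h1 : Real.sqrt (((n + k₀ : ℕ) : ℝ) + 1) ≤ 2 * Real.sqrt ((j : ℝ) + 1) := by
      rw [Real.sqrt_le_left (by positivity), mul_pow, Real.sq_sqrt (by positivity)]
      have h2 : n + k₀ ≤ 2 * j := by have := hL n; omega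
      have h3 : ((n + k₀ : ℕ) : ℝ) ≤ 2 * j := by exact_mod_cast h2
      linarith
    simp only [he]
    rw [mul_one_div, mul_one_div, div_le_div_iff₀ (hsq j) (hsq (n + k₀))]
    nlinarith
  have hY : HasMomentRate μ (fun j ω => |w ω j i - θ i| + e j)
      (fun j => 1 / Real.sqrt ((j : ℝ) + 1)) :=
    hrate.abs.add (HasMomentRate.of_le_const hc0 fun j => by rw [abs_of_nonneg (he' j)]) hr0
  have hnear : HasMomentRate μ (fun (n : ℕ) ω => |w ω (n + k₀) i - θ i| +
      ∑ l ∈ Finset.Ico (n + k₀ - Nat.sqrt (n + k₀)) (n + k₀), |w ω (l + 1) i - w ω l i| +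
      2 * c * (1 / Real.sqrt (((n + k₀ : ℕ) : ℝ) + 1)))
      (fun n => 1 / Real.sqrt (((n + k₀ : ℕ) : ℝ) + 1)) := by
    refine HasMomentRate.add (HasMomentRate.add (hrate.abs.comp fun n => n + k₀) ?_
      fun n => hr0 _) (HasMomentRate.of_le_const (by positivity : 0 ≤ 2 * c) fun n => ?_)
      fun n => hr0 _
    · refine HasMomentRate.sum_of_le (X := fun (_ : ℕ) l ω => |w ω (l + 1) i - w ω l i|)
        (f := fun _ l => 1 / ((l : ℝ) + 1))
        (J := fun n => Finset.Ico (n + k₀ - Nat.sqrt (n + k₀)) (n + k₀))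
        (hinc.abs.comp Prod.snd) (fun _ _ => by positivity) (C := 2) zero_le_two fun n => ?_
      have hLn := hL n
      have hcard : (Finset.Ico (n + k₀ - Nat.sqrt (n + k₀)) (n + k₀)).card = Nat.sqrt (n + k₀) := by
        rw [Nat.card_Ico]; omega
      have h1 := Finset.sum_le_card_nsmul (Finset.Ico (n + k₀ - Nat.sqrt (n + k₀)) (n + k₀))
        (fun l : ℕ => 1 / ((l : ℝ) + 1)) (2 / (((n + k₀ : ℕ) : ℝ) + 1)) (fun l hl => by
          have hl' : n + k₀ ≤ 2 * l := by rw [Finset.mem_Ico] at hl; omega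
          have h3 : ((n + k₀ : ℕ) : ℝ) ≤ 2 * l := by exact_mod_cast hl'
          rw [div_le_div_iff₀ (by positivity) (by positivity)]
          linarith)
      refine h1.trans ?_
      rw [hcard, nsmul_eq_mul, mul_div_assoc', mul_one_div,
        div_le_div_iff₀ (by positivity) (hsq _)]
      have h4 : (Nat.sqrt (n + k₀) : ℝ) ≤ Real.sqrt (((n + k₀ : ℕ) : ℝ) + 1) := by
        refine (Real.nat_sqrt_le_real_sqrt).trans (Real.sqrt_le_sqrt (by linarith))
      have h5 := Real.mul_self_sqrt (by positivity : (0 : ℝ) ≤ ((n + k₀ : ℕ) : ℝ) + 1)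
      nlinarith [hsq (n + k₀)]
    · rw [abs_of_nonneg (mul_nonneg (by positivity) (hr0 _))]
  set s : ℕ → ℕ → ℝ := fun k j => βlow / (2 * N) * (((k : ℝ) - j) / (k : ℝ) ^ α) with hs
  have hfar : HasMomentRate μ (fun (n : ℕ) ω =>
      ∑ j ∈ Finset.range (n + k₀ - Nat.sqrt (n + k₀)), (|w ω j i - θ i| + e j) ^ (q + 1) *
        (s (n + k₀) j ^ q)⁻¹)
      (fun n => 1 / Real.sqrt (((n + k₀ : ℕ) : ℝ) + 1)) := by
    have hterm : HasMomentRate μ (fun (x : ℕ × ℕ) ω => (|w ω x.2 i - θ i| + e x.2) ^ (q + 1) *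
        (s (x.1 + k₀) x.2 ^ q)⁻¹)
        (fun x => (1 / Real.sqrt ((x.2 : ℝ) + 1)) ^ (q + 1) * |(s (x.1 + k₀) x.2 ^ q)⁻¹|) :=
      ((hY.pow hr0 (q + 1)).comp Prod.snd).mul
        (HasMomentRate.of_le_const zero_le_one fun x => by rw [one_mul])
        fun x => pow_nonneg (hr0 _) _
    refine HasMomentRate.sum_of_le
      (X := fun n j ω => (|w ω j i - θ i| + e j) ^ (q + 1) * (s (n + k₀) j ^ q)⁻¹)
      (f := fun n j => (1 / Real.sqrt ((j : ℝ) + 1)) ^ (q + 1) * |(s (n + k₀) j ^ q)⁻¹|)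
      (J := fun n => Finset.range (n + k₀ - Nat.sqrt (n + k₀)))
      hterm (fun n j => mul_nonneg (pow_nonneg (hr0 _) _) (abs_nonneg _))
      (C := 2 * (4 * N / βlow) ^ q) (by positivity) fun n => ?_
    generalize hkdef : n + k₀ = k
    have hk4 : 4 ≤ k := hkdef ▸ hbig n
    have hk0 : (0 : ℝ) < k := by exact_mod_cast (by omega : 0 < k)
    have hsk : 0 < Real.sqrt (k : ℝ) := Real.sqrt_pos.2 hk0
    have hbound : ∀ j ∈ Finset.range (k - Nat.sqrt k),
        (1 / Real.sqrt ((j : ℝ) + 1)) ^ (q + 1) * |(s k j ^ q)⁻¹| ≤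
          (4 * N / βlow) ^ q * (1 / (k * Real.sqrt k)) := by
      intro j hj
      have hjk : j + Nat.sqrt k < k := by rw [Finset.mem_range] at hj; omega
      have hkj : (0 : ℝ) < (k : ℝ) - j := by
        have : (j : ℝ) < k := by exact_mod_cast (by omega : j < k)
        linarith
      have hhalf := half_le_sqrt_mul_sub hjk
      have hka := Real.rpow_pos_of_pos hk0 α
      have hN' : (0 : ℝ) < N := by exact_mod_cast hN
      have hspos : 0 < s k j := by simp only [hs]; positivity
      have h1 : 1 / Real.sqrt ((j : ℝ) + 1) ≤ 1 :=
        div_le_one_of_le₀ (Real.one_le_sqrt.2 (by linarith [Nat.cast_nonneg (α := ℝ) j]))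
          (Real.sqrt_nonneg _)
      have h2 : 1 / Real.sqrt ((j : ℝ) + 1) * (s k j)⁻¹ ≤ 4 * N / βlow * ((k : ℝ) ^ α / k) := by
        have h3 : 1 / Real.sqrt ((j : ℝ) + 1) * (s k j)⁻¹ =
            2 * N * (k : ℝ) ^ α / βlow * (1 / (Real.sqrt ((j : ℝ) + 1) * ((k : ℝ) - j))) := by
          have := (hsq j).ne'
          simp only [hs]
          field_simp
        have h4 : 1 / (Real.sqrt ((j : ℝ) + 1) * ((k : ℝ) - j)) ≤ 2 / k := by
          rw [div_le_div_iff₀ (mul_pos (hsq j) hkj) hk0]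
          linarith
        rw [h3]
        calc _ ≤ 2 * N * (k : ℝ) ^ α / βlow * (2 / k) := by gcongr
          _ = _ := by ring
      -- Of the `q + 1` factors `1/√(j+1)`, `q` are paired with the factors `1/s`; the remaining one
      -- is bounded by `1`.
      rw [abs_of_nonneg (by positivity), pow_succ, mul_right_comm, ← inv_pow, ← mul_pow]
      have h5 : 0 ≤ 1 / Real.sqrt ((j : ℝ) + 1) * (s k j)⁻¹ := by positivity
      calc _ ≤ (1 / Real.sqrt ((j : ℝ) + 1) * (s k j)⁻¹) ^ q * 1 :=
            mul_le_mul_of_nonneg_left h1 (by positivity)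
        _ ≤ (4 * N / βlow * ((k : ℝ) ^ α / k)) ^ q := by
            rw [mul_one]; exact pow_le_pow_left₀ h5 h2 q
        _ ≤ _ := by
            rw [mul_pow]
            exact mul_le_mul_of_nonneg_left (rpow_div_pow_le hq' (by omega)) (by positivity)
    refine (Finset.sum_le_card_nsmul _ _ _ hbound).trans ?_
    rw [Finset.card_range, nsmul_eq_mul]
    have h6 : ((k - Nat.sqrt k : ℕ) : ℝ) ≤ k := by exact_mod_cast Nat.sub_le _ _
    have h7 : 1 / Real.sqrt k ≤ 2 * (1 / Real.sqrt ((k : ℝ) + 1)) := by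
      rw [mul_one_div, div_le_div_iff₀ hsk (hsq k)]
      linarith [sqrt_succ_le k (by omega)]
    calc _ ≤ (k : ℝ) * ((4 * N / βlow) ^ q * (1 / (k * Real.sqrt k))) := by gcongr
      _ = (4 * N / βlow) ^ q * (1 / Real.sqrt k) := by field_simp
      _ ≤ (4 * N / βlow) ^ q * (2 * (1 / Real.sqrt ((k : ℝ) + 1))) := by gcongr
      _ = _ := by ring
  refine (hnear.add hfar fun n => hr0 _).of_abs_le
    (fun n => ((measurable_remoteEst hw α β θ₀ _ i).sub_const _).aestronglyMeasurable)
    fun n => ae_of_all _ fun ω => ?_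
  exact (abs_remoteEst_sub_le (by linarith) hβlow hβ (w ω) θ θ₀ i he0 hes he'
    (hbd n) (hlarge n) q).trans (le_abs_self _)

end RemoteMoments

/-! ### Application to the ARX system. -/

section System

variable {Ω : Type*} {m n : ℕ} {a : Fin m → ℝ} {b : Fin n → ℝ} {y u : ℤ → Ω → ℝ} {d : ℕ → Ω → ℝ}

theorem pastData_mono : Monotone (pastData y u) := by
  intro k k' hk
  refine iSup₂_le fun l hl => le_iSup₂_of_le l ?_ le_rfl
  rw [Finset.mem_range] at *
  omega

theorem IsARXSystem.measurable_output_pastData (hsys : IsARXSystem a b y u d) {l : ℤ} {k : ℕ}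
    (hl : l < k) : Measurable[pastData y u k] (y l) := by
  rcases le_or_gt l 0 with h0 | h0
  · rw [funext (hsys.output_zero l h0)]
    exact measurable_const
  · lift l to ℕ using h0.le
    exact (comap_measurable (y l)).mono (le_iSup₂_of_le l (Finset.mem_range.2 (by omega))
      le_sup_left) le_rfl

theorem IsARXSystem.measurable_input_pastData (hsys : IsARXSystem a b y u d) {l : ℤ} {k : ℕ}
    (hl : l < k) : Measurable[pastData y u k] (u l) := by
  rcases lt_or_ge l 0 with h0 | h0
  · rw [funext (hsys.input_zero l h0)]
    exact measurable_const
  · lift l to ℕ using h0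
    exact (comap_measurable (u l)).mono (le_iSup₂_of_le l (Finset.mem_range.2 (by omega))
      le_sup_right) le_rfl

theorem IsARXSystem.output_eq (hsys : IsARXSystem a b y u d) (ω : Ω) (k : ℕ) (hk : 1 ≤ k) :
    y (k : ℤ) ω = regressor m n (fun t => y t ω) (fun t => u t ω) k ⬝ᵥ param a b + d k ω := by
  have h := hsys.equation k hk ω
  simp only [dotProduct, regressor, param, Fin.sum_univ_add, Fin.append_left, Fin.append_right,
    neg_mul, Finset.sum_neg_distrib]
  simp only [mul_comm (a _), mul_comm (b _)] at h
  linarith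

theorem IsARXSystem.measurable_regressor_pastData (hsys : IsARXSystem a b y u d) (k : ℕ)
    (i : Fin (m + n)) : Measurable[pastData y u k] fun ω =>
      regressor m n (fun t => y t ω) (fun t => u t ω) k i := by
  refine Fin.addCases (fun i => ?_) (fun j => ?_) i
  · simp only [regressor, Fin.append_left]
    exact (hsys.measurable_output_pastData (by omega)).neg
  · simp only [regressor, Fin.append_right]
    exact hsys.measurable_input_pastData (by omega)

/-- The system equation recovers `d k` from the data up to time `k`, so the past data form a
filtration to which the noise sums are adapted. -/
theorem IsARXSystem.measurable_noise_pastData (hsys : IsARXSystem a b y u d) {k : ℕ}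
    (hk : 1 ≤ k) : Measurable[pastData y u (k + 1)] (d k) := by
  have h : d k = fun ω => y (k : ℤ) ω -
      regressor m n (fun t => y t ω) (fun t => u t ω) k ⬝ᵥ param a b := by
    funext ω
    rw [hsys.output_eq ω k hk]
    ring
  rw [h]
  refine (hsys.measurable_output_pastData (by push_cast; omega)).sub ?_
  exact Finset.measurable_fun_sum _ fun i _ =>
    ((hsys.measurable_regressor_pastData k i).mono (pastData_mono (Nat.le_succ k))
      le_rfl).mul_const _

variable [mΩ : MeasurableSpace Ω] {μ : Measure Ω}

theorem pastData_le (hy : ∀ k, Measurable (y k)) (hu : ∀ k, Measurable (u k)) (k : ℕ) :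
    pastData y u k ≤ mΩ :=
  iSup₂_le fun l _ => sup_le (hy l).comap_le (hu l).comap_le

theorem hasMomentRate_of_hasLaw_gaussian {v : ℝ≥0}
    (h : ∀ k : ℕ, 1 ≤ k → HasLaw (d k) (gaussianReal 0 v) μ) :
    HasMomentRate μ (fun k => d (k + 1)) (fun _ => 1) := by
  intro p
  have hm : MemLp (id : ℝ → ℝ) p (gaussianReal 0 v) :=
    memLp_id_gaussianReal' p (ENNReal.natCast_ne_top p)
  refine ⟨(eLpNorm (id : ℝ → ℝ) p (gaussianReal 0 v)).toReal, ENNReal.toReal_nonneg, fun k => ?_⟩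
  have hk := h (k + 1) (by omega)
  refine ⟨hk.aemeasurable.aestronglyMeasurable, ?_⟩
  rw [mul_one, ENNReal.ofReal_toReal hm.2.ne, ← hk.map_eq,
    eLpNorm_map_measure (by fun_prop) hk.aemeasurable]
  rfl

theorem integral_eq_zero_of_hasLaw_gaussian {v : ℝ≥0} {X : Ω → ℝ}
    (h : HasLaw X (gaussianReal 0 v) μ) : ∫ ω, X ω ∂μ = 0 := by
  have := integral_map (μ := μ) (f := (id : ℝ → ℝ)) h.aemeasurable (by fun_prop)
  rw [h.map_eq] at this
  simpa using this.symm

variable [IsProbabilityMeasure μ]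

/-- The output, the input and hence all regressor entries are linear processes driven by a common
noise family. -/
theorem exists_linearProcess (hsys : IsARXSystem a b y u d) (hdata : DataAssumption μ m n y u) :
    (∀ k, Measurable (y k)) ∧ (∀ k, Measurable (u k)) ∧
    ∃ (q : ℕ) (ξ : ℕ × Fin q → Ω → ℝ), IsNoiseFamily μ ξ ∧ IsLinearProcess μ ξ y ∧
      IsLinearProcess μ ξ u := by
  obtain ⟨q, r, e, δ, fy, fu, hy, hu, g, -, he, hyeq, hueq, hbd, hg⟩ := hdata.generated
  have hmeas : ∀ {X : ℤ → Ω → ℝ} {M : ℕ → ℝ} {H : ℕ → Fin q → ℕ → ℝ},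
      (∀ k : ℤ, k < 0 → ∀ ω, X k ω = 0) →
      (∀ k : ℕ, ∀ ω, X (k : ℤ) ω =
        M k + ∑ i ∈ Finset.Icc 0 k, ∑ c, H k c i * e (k - i) c ω) →
      ∀ k, Measurable (X k) := by
    intro X M H hneg hX k
    rcases lt_or_ge k 0 with h0 | h0
    · rw [funext (hneg k h0)]
      exact measurable_const
    · lift k to ℕ using h0
      rw [funext (hX k)]
      exact measurable_const.add (Finset.measurable_fun_sum _ fun i _ =>
        Finset.measurable_fun_sum _ fun c _ => (he.measurable _ _).const_mul _)
  -- The filter formula for `y` starts at time `1`; at time `0` the output vanishes, and zero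
  -- coefficients extend the formula.
  have hyeq' : ∀ k : ℕ, ∀ ω, y (k : ℤ) ω =
      (if k = 0 then 0 else ∑ i ∈ Finset.Icc 1 k, fy k i * r (k - i)) +
        ∑ i ∈ Finset.Icc 0 k, ∑ c, (if k = 0 then 0 else hy k c i) * e (k - i) c ω := by
    intro k ω
    rcases Nat.eq_zero_or_pos k with rfl | hk
    · simpa using hsys.output_zero 0 le_rfl ω
    · simp only [hk.ne', if_false]
      exact hyeq k hk ω
  have hyneg : ∀ k : ℤ, k < 0 → ∀ ω, y k ω = 0 := fun k hk => hsys.output_zero k hk.le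
  obtain ⟨⟨Cy, hy1, hy2⟩, -⟩ := hdata.quasiStationary_output
  obtain ⟨⟨Cu, hu1, hu2⟩, -⟩ := hdata.quasiStationary_input
  refine ⟨hmeas hyneg hyeq', hmeas hsys.input_zero hueq, q, fun s => e s.1 s.2, he.isNoiseFamily,
    isLinearProcess_of_filter he hyneg hyeq' (g := g) (fun k i hk hi c => ?_) hg
      (fun k hk => (hy1 k (by exact_mod_cast hk)).2.le)
      (fun k hk => (le_abs_self _).trans
        (hy2 k k (by exact_mod_cast hk) (by exact_mod_cast hk)).2.le),
    isLinearProcess_of_filter he hsys.input_zero hueq (g := g)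
      (fun k i hk hi c => ((hbd k i hk hi).2.2 c).2) hg
      (fun k hk => (hu1 k (by exact_mod_cast hk)).2.le)
      (fun k hk => (le_abs_self _).trans
        (hu2 k k (by exact_mod_cast hk) (by exact_mod_cast hk)).2.le)⟩
  rw [if_neg (by omega)]
  exact ((hbd k i hk hi).2.2 c).1

/-- Moment rates of the recursive least-squares estimate of the system parameters. -/
theorem hasMomentRate_rlsEst_regressor [NeZero (m + n)] {δd : ℝ≥0}
    (hsys : IsARXSystem a b y u d) (hdata : DataAssumption μ m n y u)
    (hnoise : IsGaussianObservationNoise μ y u d δd)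
    {P₀ : Matrix (Fin (m + n)) (Fin (m + n)) ℝ} (hP₀ : P₀.PosDef) (θ₀ : Fin (m + n) → ℝ) :
    (∀ k i, Measurable fun ω =>
      rlsEst (regressor m n (fun t => y t ω) (fun t => u t ω)) (fun t => y t ω) P₀ θ₀ k i) ∧
    (∀ i, HasMomentRate μ (fun k ω =>
      rlsEst (regressor m n (fun t => y t ω) (fun t => u t ω)) (fun t => y t ω) P₀ θ₀ k i -
        param a b i) (fun k => 1 / Real.sqrt (k + 1))) ∧
    ∀ i, HasMomentRate μ (fun k ω =>
      rlsEst (regressor m n (fun t => y t ω) (fun t => u t ω)) (fun t => y t ω) P₀ θ₀ (k + 1) i -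
        rlsEst (regressor m n (fun t => y t ω) (fun t => u t ω)) (fun t => y t ω) P₀ θ₀ k i)
      (fun k => 1 / ((k : ℝ) + 1)) := by
  obtain ⟨hym, hum, q, ξ, hξ, hylin, hulin⟩ := exists_linearProcess hsys hdata
  obtain ⟨R, hR, hE⟩ := hdata.excitation
  have hF := pastData_le hym hum
  set φ : Ω → ℕ → Fin (m + n) → ℝ := fun ω => regressor m n (fun t => y t ω) (fun t => u t ω)
    with hφdef
  have hφm : ∀ k i, Measurable fun ω => φ ω k i := fun k i =>
    (hsys.measurable_regressor_pastData k i).mono (hF k) le_rfl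
  have hlin : ∀ i, ∃ X : ℤ → Ω → ℝ, IsLinearProcess μ ξ X ∧
      ∀ (k : ℕ) ω, φ ω k i = X (k : ℤ) ω := by
    intro i
    refine Fin.addCases (fun i => ?_) (fun j => ?_) i
    · refine ⟨_, (hylin.shift (c := 1 + (i : ℕ)) (by positivity)).neg, fun k ω => ?_⟩
      simp only [hφdef, regressor, Fin.append_left, sub_sub]
    · refine ⟨_, hulin.shift (c := 1 + (j : ℕ)) (by positivity), fun k ω => ?_⟩
      simp only [hφdef, regressor, Fin.append_right, sub_sub]
  choose X hX hφX using hlin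
  have hφr : ∀ i, HasMomentRate μ (fun k ω => φ ω k i) (fun _ => 1) := by
    intro i
    simp only [hφX]
    exact ((hX i).hasMomentRate hξ).comp (Nat.cast : ℕ → ℤ)
  have hd := hasMomentRate_of_hasLaw_gaussian hnoise.law
  have hgram : ∀ i j, HasMomentRate μ (fun K ω => gram (φ ω) K i j -
      (Matrix.of fun i j => ∑ l ∈ Finset.Icc 1 K, ∫ ω, φ ω l i * φ ω l j ∂μ) i j)
      (fun K => Real.sqrt (K + 1)) := by
    intro i j
    simp only [gram, Matrix.of_apply, hφX]
    exact (hX i).hasMomentRate_sum_mul hξ (hX j)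
  have hM : ∀ i, HasMomentRate μ (fun (K : ℕ) ω => ∑ l ∈ Finset.Icc 1 K, d l ω * φ ω l i)
      (fun K => Real.sqrt (K + 1)) := fun i =>
    hasMomentRate_sum_noise_mul hF pastData_mono
      (fun k hk => hsys.measurable_noise_pastData hk)
      (fun k _ => hsys.measurable_regressor_pastData k i) hnoise.indep_past
      (fun k hk => integral_eq_zero_of_hasLaw_gaussian (hnoise.law k hk)) hd
      ((hφr i).comp fun k => k + 1)
  exact ⟨measurable_rlsEst hφm (fun k => hym k) P₀ θ₀,
    hasMomentRate_rlsEst hφm (fun k => hym k) (fun ω k hk => hsys.output_eq ω k hk) hφr hd hgram hM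
      hP₀ hR hE⟩

end System

/-! ### Assembly in the Euclidean norm. -/

theorem euclidean_norm_le_sum_abs {N : ℕ} (v : EuclideanSpace ℝ (Fin N)) : ‖v‖ ≤ ∑ i, |v i| := by
  rw [EuclideanSpace.norm_eq]
  refine Real.sqrt_le_iff.2 ⟨Finset.sum_nonneg fun _ _ => abs_nonneg _, ?_⟩
  simpa using Finset.sum_sq_le_sq_sum_of_nonneg (s := Finset.univ) (f := fun i => |v i|)
    fun _ _ => abs_nonneg _

theorem one_div_sqrt_succ_pow_le {k : ℕ} (hk : 1 ≤ k) (p : ℕ) :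
    (1 / Real.sqrt ((k : ℝ) + 1)) ^ p ≤ 1 / (k : ℝ) ^ ((p : ℝ) / 2) := by
  have hk0 : (0 : ℝ) < k := by exact_mod_cast hk
  have h1 : (k : ℝ) ^ ((p : ℝ) / 2) = Real.sqrt k ^ p := by
    rw [Real.sqrt_eq_rpow, ← Real.rpow_mul_natCast hk0.le]
    congr 1
    ring
  rw [h1, div_pow, one_pow]
  have := Real.sqrt_pos.2 hk0
  gcongr
  linarith

end RLSSA

theorem theorem3 {Ω : Type*} [MeasurableSpace Ω] (μ : Measure Ω) [IsProbabilityMeasure μ]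
    (m n : ℕ) [NeZero (m + n)]
    (a : Fin m → ℝ) (b : Fin n → ℝ) (y u : ℤ → Ω → ℝ) (d : ℕ → Ω → ℝ) (δd : ℝ≥0)
    (hsys : RLSSA.IsARXSystem a b y u d)
    (hdata : RLSSA.DataAssumption μ m n y u)
    (hstable : RLSSA.IsStablePolynomial a)
    (hnoise : RLSSA.IsGaussianObservationNoise μ y u d δd)
    (P₀ : Matrix (Fin (m + n)) (Fin (m + n)) ℝ) (hP₀ : P₀.PosDef)
    (θRLS₀ θ₀ : Fin (m + n) → ℝ)
    (α : ℝ) (hα : 1 / 2 < α) (hα' : α < 1)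
    (β : ℕ → ℝ) (βlow βhigh : ℝ) (hβlow : 0 < βlow)
    (hβ : ∀ k : ℕ, 1 ≤ k → βlow ≤ β k ∧ β k ≤ βhigh)
    (err : ℕ → Ω → EuclideanSpace ℝ (Fin (m + n)))
    (herr : ∀ k ω, err k ω =
      RLSSA.rlssa m n P₀ θRLS₀ θ₀ α β (fun t => y t ω) (fun t => u t ω) k -
        WithLp.toLp 2 (RLSSA.param a b))
    (p : ℕ) (hp : 1 ≤ p) :
    (∀ k, Integrable (fun ω => ‖err k ω‖ ^ p) μ) ∧
    Tendsto (fun k : ℕ => ∫ ω, ‖err k ω‖ ^ p ∂μ) atTop (𝓝 0) ∧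
    (fun k : ℕ => ∫ ω, ‖err k ω‖ ^ p ∂μ) =O[atTop]
      (fun k : ℕ => 1 / (k : ℝ) ^ ((p : ℝ) / 2)) := by
  obtain ⟨hwm, hw, hinc⟩ := RLSSA.hasMomentRate_rlsEst_regressor hsys hdata hnoise hP₀ θRLS₀
  set w : Ω → ℕ → Fin (m + n) → ℝ := fun ω =>
    RLSSA.rlsEst (RLSSA.regressor m n (fun t => y t ω) (fun t => u t ω)) (fun t => y t ω) P₀ θRLS₀
    with hwdef
  have happ : ∀ k ω i, err k ω i =
      RLSSA.remoteEst (w ω) α β θ₀ k i - RLSSA.param a b i := by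
    intro k ω i
    rw [herr]
    rfl
  have hmeas : ∀ k, Measurable fun ω => ‖err k ω‖ := by
    intro k
    simp only [EuclideanSpace.norm_eq, happ]
    exact (Finset.measurable_fun_sum _ fun i _ =>
      ((RLSSA.measurable_remoteEst hwm α β θ₀ k i).sub_const _).norm.pow_const 2).sqrt
  have hO : (fun k : ℕ => ∫ ω, ‖err k ω‖ ^ p ∂μ) =O[atTop]
      (fun k : ℕ => 1 / (k : ℝ) ^ ((p : ℝ) / 2)) := by
    -- From this time on `√k ≥ 2N`, so every gap longer than `√k` contains enough updates of each
    -- coordinate.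
    set k₀ := (2 * (m + n)) ^ 2 with hk₀
    have hrate : RLSSA.HasMomentRate μ (fun (j : ℕ) ω => ‖err (j + k₀) ω‖)
        (fun j => 1 / Real.sqrt (((j + k₀ : ℕ) : ℝ) + 1)) := by
      refine (RLSSA.HasMomentRate.finset_sum Finset.univ (fun i _ =>
        (RLSSA.hasMomentRate_remoteEst hα hα' hβlow hβ hwm (θ₀ := θ₀) i (hw i) (hinc i)
          (k₀ := k₀) le_rfl).abs) fun j => by positivity).of_abs_le
        (fun j => (hmeas _).aestronglyMeasurable) fun j => ae_of_all _ fun ω => ?_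
      rw [abs_of_nonneg (norm_nonneg _)]
      refine ((RLSSA.euclidean_norm_le_sum_abs _).trans_eq ?_).trans (le_abs_self _)
      simp only [happ, hwdef]
    obtain ⟨C, hC, hb⟩ := hrate.integral_pow_le (fun j => by positivity) hp
    refine Asymptotics.IsBigO.of_bound C ?_
    filter_upwards [eventually_ge_atTop (k₀ + 1)] with k hk
    obtain ⟨j, rfl⟩ : ∃ j, k = j + k₀ := ⟨k - k₀, by omega⟩
    have h1 := hb j
    simp only [abs_norm] at h1
    rw [Real.norm_of_nonneg (integral_nonneg fun ω => by positivity),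
      Real.norm_of_nonneg (by positivity)]
    exact h1.trans (mul_le_mul_of_nonneg_left (RLSSA.one_div_sqrt_succ_pow_le (by omega) p) hC)
  refine ⟨fun k => ?_, hO.trans_tendsto ?_, hO⟩
  -- At each fixed time the remote estimate is bounded by a deterministic constant, since it moves
  -- by deterministic amounts whatever the bits are.
  · refine Integrable.of_bound ((hmeas k).pow_const p).aestronglyMeasurable
      ((∑ i, (|θ₀ i| + ∑ l ∈ Finset.Icc 1 k, |RLSSA.stepSize α β i l| +
        |RLSSA.param a b i|)) ^ p) (ae_of_all _ fun ω => ?_)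
    rw [norm_pow, norm_norm]
    refine pow_le_pow_left₀ (norm_nonneg _) ((RLSSA.euclidean_norm_le_sum_abs _).trans ?_) p
    refine Finset.sum_le_sum fun i _ => ?_
    rw [happ]
    exact (abs_sub _ _).trans (add_le_add_left (RLSSA.abs_remoteEst_le α β θ₀ k i) _)
  · have hp' : (0 : ℝ) < (p : ℝ) / 2 := by
      have : (1 : ℝ) ≤ p := by exact_mod_cast hp
      linarith
    have := ((tendsto_rpow_atTop hp').comp tendsto_natCast_atTop_atTop).inv_tendsto_atTop
    exact this.congr fun k => by simp
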